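/- A one-way $k$-counter machine $M=(k,Q,\Sigma,\lhd,\delta,q_0,F)$ has a finite set $Q$ of states, a finite input alphabet $\Sigma$, a right end-marker $\lhd\notin\Sigma$, an initial state $q_0\in Q$, accepting states $F\subseteq Q$, and a transition relation $\delta$ from $Q\times(\Sigma\cup\{\lhd\})\times\{0,1\}^k$ to $Q\times\{\mathrm S,\mathrm R\}\times\{-1,0,1\}^k$. In one step $M$ reads its state, the scanned symbol and, for each counter, whether it is zero ($0$) or positive ($1$); it then changes its state, keeps the input head in place ($\mathrm S$) or moves it one symbol to the right ($\mathrm R$), and adds $-1$, $0$ or $1$ to each counter, where $-1$ is not allowed for a counter that is zero. An accepting computation on $w\in\Sigma^*$ starts in state $q_0$ with remaining input $w\lhd$ and all counters zero, and ends in a state of $F$ with remaining input $\lhd$. The language $L(M)$ consists of all words $w\in\Sigma^*$ that have an accepting computation. $M$ is deterministic if $\delta$ is a partial function, and $l$-reversal-bounded if in every accepting computation each counter alternates between increasing and decreasing at most $l$ times. $\mathrm{NCM}(k,l)$ denotes the class of $l$-reversal-bounded $k$-counter machines, and $\mathrm{DCM}(k,l)$ the class of the deterministic ones among them. A language $L\subseteq\Sigma^*$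 is suffix-dense if every word $w\in\Sigma^*$ is a suffix of a word of $L$, that is, if $\{w\in\Sigma^* \mid xw\in L \text{ for some } x\in\Sigma^*\}=\Sigma^*$. Proposition. For each of the three classes $\mathcal C=\mathrm{DCM}(1,3)$, $\mathcal C=\mathrm{DCM}(2,1)$ and $\mathcal C=\mathrm{NCM}(1,1)$, it is undecidable, given a machine $M\in\mathcal C$, whether $L(M)$ is suffix-dense: there is no algorithm that, for every $M\in\mathcal C$, halts on input $M$ and answers correctly whether $L(M)$ is suffix-dense. -/

import Mathlib

/-! ### Word operations and density -/

/-- The set `suff(L) = {w | x w ∈ L for some word x}` of suffixes of words of `L`. -/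
def Language.suff {α : Type*} (L : Language α) : Language α :=
  {w | ∃ x : List α, x ++ w ∈ L}

/-- `L ⊆ Σ*` is `ϱ`-dense if `ϱ(L) = Σ*`. -/
def Language.IsDenseFor {α : Type*} (ϱ : Language α → Language α) (L : Language α) : Prop :=
  ∀ w : List α, w ∈ ϱ L

/-! ### One-way multicounter machines -/

/-- One element `(p, d, d₁, …, d_k) ∈ δ(q, a, c₁, …, c_k)` of a transition relation. -/
@[ext] structure CounterTransition (k : ℕ) where
  /-- the current state `q` -/
  source : ℕ
  /-- the scanned symbol `a`: `some a` is a letter, `none` is the right end-marker -/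
  symbol : Option ℕ
  /-- the tested signs of the counters: `false` for zero, `true` for positive -/
  positive : Fin k → Bool
  /-- the next state `p` -/
  target : ℕ
  /-- the input head moves right (`true`) or stays (`false`) -/
  moveRight : Bool
  /-- the changes `d_i ∈ {-1, 0, 1}` of the counters -/
  change : Fin k → SignType

/-- A (description of a) one-way nondeterministic `k`-counter machine: the state set is
`{0, …, numStates - 1}`, the input alphabet is `{0, …, numLetters - 1}`, and the transition
relation is given by the list of its elements. -/
structure CounterMachine (k : ℕ) where
  numStates : ℕ
  numLetters : ℕ
  start : ℕ
  accepting : List ℕ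
  transitions : List (CounterTransition k)

/-- A transition as a tuple. -/
def CounterTransition.equivProd (k : ℕ) : CounterTransition k ≃
    (ℕ × Option ℕ × (Fin k → Bool)) × (ℕ × Bool × (Fin k → SignType)) where
  toFun t := ((t.source, t.symbol, t.positive), (t.target, t.moveRight, t.change))
  invFun t := ⟨t.1.1, t.1.2.1, t.1.2.2, t.2.1, t.2.2.1, t.2.2.2⟩
  left_inv _ := rfl
  right_inv _ := rfl

/-- A machine as a tuple. -/
def CounterMachine.equivProd (k : ℕ) : CounterMachine k ≃
    ℕ × ℕ × ℕ × List ℕ × List (CounterTransition k) where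
  toFun M := (M.numStates, M.numLetters, M.start, M.accepting, M.transitions)
  invFun M := ⟨M.1, M.2.1, M.2.2.1, M.2.2.2.1, M.2.2.2.2⟩
  left_inv _ := rfl
  right_inv _ := rfl

instance SignType.instPrimcodable : Primcodable SignType :=
  Primcodable.ofEquiv (Fin 3) SignType.fin3Equiv.toEquiv

instance CounterTransition.instPrimcodable (k : ℕ) : Primcodable (CounterTransition k) :=
  Primcodable.ofEquiv _ (CounterTransition.equivProd k)

/-- Machines are finite objects, and as such the possible inputs of algorithms. -/
instance CounterMachine.instPrimcodable (k : ℕ) : Primcodable (CounterMachine k) :=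
  Primcodable.ofEquiv _ (CounterMachine.equivProd k)

/-- A configuration: state, remaining input (a word over the letters and the end-marker `none`),
and contents of the counters. -/
structure CounterConfig (k : ℕ) where
  state : ℕ
  tape : List (Option ℕ)
  counter : Fin k → ℕ

namespace CounterMachine

variable {k : ℕ}

/-- `M` is a machine in the sense of the definition: all states and letters that occur belong to
the state set and to the alphabet, and no transition decrements a counter that is zero. -/
structure WellFormed (M : CounterMachine k) : Prop where
  start_lt : M.start < M.numStates
  accepting_lt : ∀ q ∈ M.accepting, q < M.numStates
  source_lt : ∀ t ∈ M.transitions, t.source < M.numStates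
  target_lt : ∀ t ∈ M.transitions, t.target < M.numStates
  symbol_lt : ∀ t ∈ M.transitions, ∀ a ∈ t.symbol, a < M.numLetters
  change_nonneg : ∀ t ∈ M.transitions, ∀ i, t.positive i = false → 0 ≤ t.change i

/-- `M` is deterministic: its transition relation is a partial function. -/
def Deterministic (M : CounterMachine k) : Prop :=
  ∀ t ∈ M.transitions, ∀ t' ∈ M.transitions,
    t.source = t'.source → t.symbol = t'.symbol → t.positive = t'.positive → t = t'

/-- One step of `M`, by the transition `t`. -/
def Step (M : CounterMachine k) (t : CounterTransition k) (c c' : CounterConfig k) : Prop :=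
  t ∈ M.transitions ∧ c.state = t.source ∧ c'.state = t.target ∧
    (∀ i, t.positive i = true ↔ 0 < c.counter i) ∧
    (∀ i, (c'.counter i : ℤ) = (c.counter i : ℤ) + (t.change i : ℤ)) ∧
    ∃ w, c.tape = t.symbol :: w ∧ c'.tape = if t.moveRight then w else c.tape

/-- `M.Computation c ts c'`: the transitions `ts`, performed one after the other, lead from `c`
to `c'`. -/
inductive Computation (M : CounterMachine k) :
    CounterConfig k → List (CounterTransition k) → CounterConfig k → Prop
  | nil (c : CounterConfig k) : Computation M c [] c
  | cons {c c' c'' : CounterConfig k} {t : CounterTransition k}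
      {ts : List (CounterTransition k)} :
      M.Step t c c' → Computation M c' ts c'' → Computation M c (t :: ts) c''

/-- The initial configuration on input `w`: initial state, `w` followed by the end-marker, and
zero in every counter. -/
def init (M : CounterMachine k) (w : List (Fin M.numLetters)) : CounterConfig k :=
  ⟨M.start, w.map (fun a : Fin M.numLetters => some a.val) ++ [none], fun _ => 0⟩

/-- `ts` is an accepting computation of `M` on `w`: it leads from the initial configuration to an
accepting state with only the end-marker left to read. -/
def AcceptingComputation (M : CounterMachine k) (w : List (Fin M.numLetters))
    (ts : List (CounterTransition k)) : Prop :=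
  ∃ c : CounterConfig k, M.Computation (M.init w) ts c ∧ c.state ∈ M.accepting ∧ c.tape = [none]

/-- The language accepted by `M`. -/
def language (M : CounterMachine k) : Language (Fin M.numLetters) :=
  {w | ∃ ts, M.AcceptingComputation w ts}

/-- The number of alternations between increasing and decreasing in a sequence of changes of a
counter, the last nonzero change before the sequence being `last` (`0` if there was none). -/
def alternations (last : SignType) : List SignType → ℕ
  | [] => 0
  | d :: ds =>
    if d = 0 then alternations last ds
    else (if last ≠ 0 ∧ last ≠ d then 1 else 0) + alternations d ds

/-- `M` is `l`-reversal-bounded: in every accepting computation, every counter alternates between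
increasing and decreasing at most `l` times. -/
def ReversalBounded (l : ℕ) (M : CounterMachine k) : Prop :=
  ∀ w ts, M.AcceptingComputation w ts →
    ∀ i, alternations 0 (ts.map fun t => t.change i) ≤ l

end CounterMachine

/-- The `l`-reversal-bounded nondeterministic `k`-counter machines. -/
def NCM (k l : ℕ) : Set (CounterMachine k) :=
  {M | M.WellFormed ∧ M.ReversalBounded l}

/-- The `l`-reversal-bounded deterministic `k`-counter machines. -/
def DCM (k l : ℕ) : Set (CounterMachine k) :=
  {M | M.WellFormed ∧ M.Deterministic ∧ M.ReversalBounded l}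

/-- The property `P` is decidable for the elements of `S`: some algorithm, given an element of
`S`, halts and says whether the element has the property. Nothing is required of it on inputs
outside of `S`, not even that it halts. -/
def DecidableOn {α : Type*} [Primcodable α] (S : Set α) (P : α → Prop) : Prop :=
  ∃ f : α →. Bool, Partrec f ∧ ∀ a ∈ S, ∃ b ∈ f a, (b = true ↔ P a)

/-! The halting problem is reduced to non-density. A run of a program is written as a word: a
register content is a block, namely a label letter `l + 2` followed by the content in unary (letters
`0`), and the letter `1` marks the beginning of a history. A block system restricts the number and
label of a block, the label of the next block, and, by an affine relation, the number of the block
`skipped + 1` places later. A history is a sequence of blocks that satisfies these local conditions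
throughout.

One violation at a known position is found by a deterministic real-time automaton with one counter
and one reversal: count up the quotient of the first number, skip some blocks, count down on the
second number. Let this checker accept the words without `1` that begin with a label whose block
violates its condition, and the words that begin with `1`, contain no further `1`, and do not
continue with the prescribed initial blocks. If a history with the prescribed beginning exists, then
`1` followed by it is comparable, in the suffix order, with no accepted word: its own suffixes show
no fault, and a longer word has a `1` in its interior. If there is none, every word is comparable
with an accepted one: the part after its last `1` has a wrong beginning or contains a fault, and a
word `w` without `1` is a suffix of the accepted word `10w`. This is `isCheckerDense_instrs`.

The machine only has to start the checker at some position. It guesses the position or,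
deterministically, reads `0ⁿ1` and then skips `n` letters by means of a counter. Density quantifies
over left extensions, so such a prefix is always available (`isDenseFor_suff_iff`). Guessing costs
no reversal. Counting costs one, plus one for turning back to increasing if the checker reuses the
counter; this yields the three classes.

That the existence of histories is undecidable comes from Mathlib's compilation of partial recursive
functions into programs with four stacks. With stacks read as numbers in base five, reading, pushing
and popping are affine relations (`step_eq_some_iff`), and halting runs become histories
(`hasHistory_row`). For a code of a universal function, only one initial number depends on the
instance. -/

/-! ### Alternations of a counter controlled by a phase -/

namespace CounterMachine

variable {k : ℕ}

/-- The last nonzero change `last` of a counter agrees with the phase `p`: counters increase in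
even phases and decrease in odd phases. -/
def PhaseAgrees (last : SignType) (p : ℕ) : Prop :=
  (last = 1 → p % 2 = 0) ∧ (last = -1 → p % 2 = 1)

/-- Here `p` is a phase to which the change `last` belongs, hence a lower bound for the current
phase. Changes of opposite sign require phases of opposite parity; as phases never decrease, each
alternation uses up at least one of them. -/
theorem alternations_add_phase_le {M : CounterMachine k} {i : Fin k} {l : ℕ} (phase : ℕ → ℕ)
    (hl : ∀ q, phase q ≤ l)
    (hmono : ∀ t ∈ M.transitions, phase t.source ≤ phase t.target)
    (hagree : ∀ t ∈ M.transitions, PhaseAgrees (t.change i) (phase t.source))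
    {c c' : CounterConfig k} {ts : List (CounterTransition k)} (h : M.Computation c ts c') :
    ∀ (last : SignType) (p : ℕ), PhaseAgrees last p → p ≤ phase c.state →
      alternations last (ts.map fun t => t.change i) + p ≤ l := by
  induction h with
  | nil c =>
    intro last p _ hp
    simpa [alternations] using hp.trans (hl _)
  | @cons c c' c'' t ts hstep _ ih =>
    intro last p hlast hp
    obtain ⟨ht, hs, hs', -⟩ := hstep
    have hle : p ≤ phase c'.state := by
      rw [hs']; rw [hs] at hp; exact hp.trans (hmono t ht)
    simp only [List.map_cons, alternations]
    split_ifs with h0 h1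
    · exact ih last p hlast hle
    · have ha := hagree t ht
      have := ih (t.change i) (phase t.source) ha (by rw [hs']; exact hmono t ht)
      rw [hs] at hp
      have hne : p ≠ phase t.source := by
        intro he
        rw [← he] at ha
        obtain ⟨h2, h3⟩ := h1
        revert h0 h2 h3 hlast ha
        unfold PhaseAgrees
        generalize t.change i = d
        revert last d
        intro last d
        cases last <;> cases d <;> simp
      omega
    · have ha := hagree t ht
      have := ih (t.change i) (phase t.source) ha (by rw [hs']; exact hmono t ht)
      rw [hs] at hp
      omega

theorem reversalBounded_of_phase {M : CounterMachine k} {l : ℕ} (phase : Fin k → ℕ → ℕ)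
    (hl : ∀ i q, phase i q ≤ l)
    (hmono : ∀ i, ∀ t ∈ M.transitions, phase i t.source ≤ phase i t.target)
    (hagree : ∀ i, ∀ t ∈ M.transitions, PhaseAgrees (t.change i) (phase i t.source)) :
    M.ReversalBounded l := by
  rintro w ts ⟨c, hc, -⟩ i
  have := alternations_add_phase_le (phase i) (hl i) (hmono i) (hagree i) hc 0 0
    (by simp [PhaseAgrees]) (Nat.zero_le _)
  simpa using this

/-! ### Acceptance from an arbitrary configuration -/

/-- Some accepting configuration is reachable from `c`. -/
def Accepts (M : CounterMachine k) (c : CounterConfig k) : Prop :=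
  ∃ ts c', M.Computation c ts c' ∧ c'.state ∈ M.accepting ∧ c'.tape = [none]

theorem mem_language {M : CounterMachine k} {w : List (Fin M.numLetters)} :
    w ∈ M.language ↔ M.Accepts (M.init w) := Iff.rfl

theorem accepts_iff {M : CounterMachine k} {c : CounterConfig k} :
    M.Accepts c ↔ (c.state ∈ M.accepting ∧ c.tape = [none]) ∨
      ∃ t c', M.Step t c c' ∧ M.Accepts c' := by
  constructor
  · rintro ⟨ts, c', h, hacc, htape⟩
    cases h with
    | nil => exact Or.inl ⟨hacc, htape⟩
    | cons hs h => exact Or.inr ⟨_, _, hs, _, _, h, hacc, htape⟩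
  · rintro (⟨h1, h2⟩ | ⟨t, c', hs, ts, c'', h, h1, h2⟩)
    · exact ⟨[], c, .nil c, h1, h2⟩
    · exact ⟨t :: ts, c'', .cons hs h, h1, h2⟩

theorem Accepts.step {M : CounterMachine k} {t : CounterTransition k} {c c' : CounterConfig k}
    (h : M.Accepts c') (hs : M.Step t c c') : M.Accepts c :=
  accepts_iff.2 (Or.inr ⟨t, c', hs, h⟩)

@[elab_as_elim]
theorem Accepts.rec_on {M : CounterMachine k} {P : CounterConfig k → Prop}
    {c : CounterConfig k} (h : M.Accepts c)
    (hfinal : ∀ c, c.state ∈ M.accepting → c.tape = [none] → P c)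
    (hstep : ∀ t c c', M.Step t c c' → M.Accepts c' → P c' → P c) : P c := by
  obtain ⟨ts, c', h, h1, h2⟩ := h
  induction h with
  | nil c => exact hfinal c h1 h2
  | cons hs h ih => exact hstep _ _ _ hs ⟨_, _, h, h1, h2⟩ (ih h1 h2)

end CounterMachine

/-! ### Real-time checkers -/

/-- An instruction `(q, a, b, p, d)` of a one-counter automaton: in state `q`, on the symbol `a`
(`none` is the end-marker) and with sign `b` of the counter, it goes to state `p` and changes the
counter by `d`. The head moves right on letters and stays on the end-marker. -/
abbrev Instr : Type := ℕ × Option ℕ × Bool × ℕ × SignType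

/-- The instruction as a transition of a `k`-counter machine that acts on the counter `j` while
the other counters are zero. -/
def Instr.toTransition {k : ℕ} (j : Fin k) (r : Instr) : CounterTransition k :=
  ⟨r.1, r.2.1, Function.update (fun _ => false) j r.2.2.1, r.2.2.2.1, r.2.1.isSome,
    Pi.single j r.2.2.2.2⟩

/-- A list of instructions is accepting from state `q` with counter value `c` on the remaining
input `z`. -/
def CheckerAccepts (D : List Instr) : ℕ → ℕ → List ℕ → Prop
  | q, c, [] => (q, none, decide (0 < c), 2, 0) ∈ D
  | q, c, a :: z => ∃ q' d, ∃ c' : ℕ, (q, some a, decide (0 < c), q', d) ∈ D ∧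
      (c' : ℤ) = (c : ℤ) + (d : ℤ) ∧ CheckerAccepts D q' c' z

/-- Conditions on a list of instructions with `L` letters and `S` states under which it can be
prefixed by a part that locates the position where it starts to work. Its start state is `0`, the
state `1` is unused, and `2` is the only accepting state. -/
structure IsChecker (L S : ℕ) (D : List Instr) : Prop where
  source : ∀ q a b p d, (q, a, b, p, d) ∈ D → q ≠ 1 ∧ q ≠ 2 ∧ q < S
  target : ∀ q a b p d, (q, a, b, p, d) ∈ D → p ≠ 0 ∧ p ≠ 1 ∧ p < S
  symbol : ∀ q a b p d, (q, some a, b, p, d) ∈ D → a < L ∧ p ≠ 2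
  final : ∀ q b p d, (q, none, b, p, d) ∈ D → p = 2 ∧ d = 0
  nonneg : ∀ q a p d, (q, a, false, p, d) ∈ D → 0 ≤ d
  start : ∀ a b p d, (0, a, b, p, d) ∈ D → b = false ∧ d = 0
  det : ∀ q a b p d p' d', (q, a, b, p, d) ∈ D → (q, a, b, p', d') ∈ D → p = p' ∧ d = d'
  phase : ∃ phase : ℕ → ℕ, (∀ q, phase q ≤ 1) ∧ ∀ q a b p d, (q, a, b, p, d) ∈ D →
    phase q ≤ phase p ∧ CounterMachine.PhaseAgrees d (phase q)
  two_le : 2 ≤ L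
  three_le : 3 ≤ S

/-- The machine with the transitions `pre` and the instructions `D` acting on the counter `j`. -/
def checkerMachine {k : ℕ} (j : Fin k) (L S start : ℕ) (pre : List (CounterTransition k))
    (D : List Instr) : CounterMachine k :=
  ⟨S, L, start, [2], pre ++ D.map (Instr.toTransition j)⟩

/-- The input tape with contents `z`. -/
def inputTape (z : List ℕ) : List (Option ℕ) := z.map some ++ [none]

@[simp] theorem inputTape_nil : inputTape [] = [none] := rfl

@[simp] theorem inputTape_cons (a : ℕ) (z : List ℕ) :
    inputTape (a :: z) = some a :: inputTape z := rfl

theorem inputTape_eq_none {z : List ℕ} : inputTape z = [none] ↔ z = [] := by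
  cases z <;> simp

/-! ### Runs of the checker inside a machine -/

section Machine

variable {k : ℕ} {j : Fin k} {L S start : ℕ} {pre : List (CounterTransition k)} {D : List Instr}

theorem positive_update_iff {j : Fin k} {b : Bool} {c : Fin k → ℕ} :
    (∀ i, Function.update (fun _ => false) j b i = true ↔ 0 < c i) ↔
      (∀ i, i ≠ j → c i = 0) ∧ b = decide (0 < c j) := by
  constructor
  · intro h
    refine ⟨fun i hi => ?_, ?_⟩
    · have := h i
      simp [hi] at this
      exact this
    · have := h j
      simp at this
      cases b <;> simp_all
  · rintro ⟨h1, h2⟩ i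
    by_cases hi : i = j
    · subst hi; simp [h2]
    · simp [hi, h1 i hi]

theorem accepts_of_checkerAccepts {q c : ℕ} {z : List ℕ} (h : CheckerAccepts D q c z) :
    (checkerMachine j L S start pre D).Accepts ⟨q, inputTape z, Pi.single j c⟩ := by
  induction z generalizing q c with
  | nil =>
    refine CounterMachine.Accepts.step (t := Instr.toTransition j _)
      (c' := ⟨2, inputTape [], Pi.single j c⟩)
      (CounterMachine.accepts_iff.2 (Or.inl ⟨by simp [checkerMachine], rfl⟩))
      ⟨List.mem_append_right _ (List.mem_map_of_mem h), rfl, rfl, ?_, ?_, [], rfl, rfl⟩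
    · exact positive_update_iff.2 ⟨fun i hi => by simp [hi], by simp⟩
    · intro i; simp [Instr.toTransition]
  | cons a z ih =>
    obtain ⟨q', d, c', hmem, hc, h⟩ := h
    refine CounterMachine.Accepts.step (t := Instr.toTransition j _)
      (c' := ⟨q', inputTape z, Pi.single j c'⟩) (ih h)
      ⟨List.mem_append_right _ (List.mem_map_of_mem hmem), rfl, rfl, ?_, ?_,
        inputTape z, rfl, rfl⟩
    · exact positive_update_iff.2 ⟨fun i hi => by simp [hi], by simp⟩
    · intro i
      by_cases hi : i = j
      · subst hi; simpa [Instr.toTransition] using hc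
      · simp [Instr.toTransition, hi]

/-- Transitions that lead from the states `0` and `1` to these states and read a letter. -/
def IsLocator (pre : List (CounterTransition k)) : Prop :=
  ∀ t ∈ pre, t.source ≤ 1 ∧ t.target ≤ 1 ∧ t.symbol ≠ none ∧ t.moveRight = true

/-- No locating transition starts in a state above `1`, so only instructions are used. The case `q =
2` is separate because a run may stop there without the final instruction that `CheckerAccepts` asks
for. -/
theorem checkerAccepts_of_accepts (hpre : IsLocator pre) (hD : IsChecker L S D)
    {C : CounterConfig k} (h : (checkerMachine j L S start pre D).Accepts C) :
    ∀ ⦃q c : ℕ⦄ ⦃z : List ℕ⦄, C = ⟨q, inputTape z, Pi.single j c⟩ → 2 ≤ q →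
      (q = 2 ∧ z = []) ∨ CheckerAccepts D q c z := by
  refine h.rec_on ?_ ?_
  · rintro C hs ht q c z rfl -
    exact Or.inl ⟨by simpa [checkerMachine] using hs, inputTape_eq_none.1 ht⟩
  · rintro t C C' ⟨ht, hs, hs', hpos, hch, w, htape, htape'⟩ - ih q c z rfl hq
    right
    rcases List.mem_append.1 ht with ht | ht
    · have := (hpre t ht).1
      simp only at hs
      omega
    obtain ⟨⟨q₁, a, b, p, d⟩, hmem, rfl⟩ := List.mem_map.1 ht
    simp only [Instr.toTransition] at hs hs' hpos hch htape htape'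
    subst hs
    obtain ⟨-, hb⟩ := positive_update_iff.1 hpos
    simp only [Pi.single_eq_same] at hb
    subst hb
    have hC' : C'.counter = Pi.single j (C'.counter j) := by
      funext i
      by_cases hi : i = j
      · subst hi; simp
      · have := hch i
        simp [hi] at this
        simp [hi, this]
    have hcj := hch j
    simp only [Pi.single_eq_same] at hcj
    cases z with
    | nil =>
      simp only [inputTape_nil, List.cons.injEq] at htape
      obtain ⟨rfl, rfl⟩ := htape
      obtain ⟨rfl, rfl⟩ := hD.final _ _ _ _ hmem
      exact hmem
    | cons a' z =>
      simp only [inputTape_cons, List.cons.injEq] at htape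
      obtain ⟨rfl, rfl⟩ := htape
      refine ⟨p, d, C'.counter j, hmem, hcj, ?_⟩
      have hp := hD.target _ _ _ _ _ hmem
      have hp2 := (hD.symbol _ _ _ _ _ hmem).2
      refine (ih (q := p) (c := C'.counter j) (z := z) ?_ (by omega)).resolve_left (by tauto)
      obtain ⟨s', tape', counter'⟩ := C'
      rw [CounterConfig.mk.injEq]
      exact ⟨hs', by simpa using htape', hC'⟩

/-- The letters read by locating transitions form `y`. The first instruction is executed in state
`0` and, by the condition `start`, only when all counters are zero, so the checker begins with a
clean counter whatever the locating part did. -/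
theorem exists_checkerAccepts_of_accepts (hpre : IsLocator pre) (hD : IsChecker L S D)
    {C : CounterConfig k} (h : (checkerMachine j L S start pre D).Accepts C) :
    ∀ ⦃z : List ℕ⦄, C.tape = inputTape z → C.state ≤ 1 →
      ∃ y z', z = y ++ z' ∧ CheckerAccepts D 0 0 z' := by
  refine h.rec_on ?_ ?_
  · intro C hs ht z hz hle
    simp only [checkerMachine, List.mem_singleton] at hs
    omega
  · intro t C C' hstep hacc ih z hz hle
    have hstep' := hstep
    obtain ⟨ht, hs, hs', hpos, hch, w, htape, htape'⟩ := hstep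
    rcases List.mem_append.1 ht with ht | ht
    · obtain ⟨h1, h2, h3, h4⟩ := hpre t ht
      rw [h4, if_pos rfl] at htape'
      cases z with
      | nil =>
        rw [hz, inputTape_nil, List.cons.injEq] at htape
        exact absurd htape.1.symm h3
      | cons a z =>
        rw [hz, inputTape_cons, List.cons.injEq] at htape
        obtain ⟨y, z', rfl, hz'⟩ := ih (z := z) (by rw [htape', htape.2]) (by rw [hs']; exact h2)
        exact ⟨a :: y, z', rfl, hz'⟩
    · obtain ⟨⟨q₁, a, b, p, d⟩, hmem, rfl⟩ := List.mem_map.1 ht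
      have hq : q₁ = 0 := by
        have := hD.source _ _ _ _ _ hmem
        simp only [Instr.toTransition] at hs
        omega
      subst hq
      obtain ⟨rfl, -⟩ := hD.start _ _ _ _ hmem
      obtain ⟨h0, hb⟩ := positive_update_iff.1 hpos
      have hC : C = ⟨0, inputTape z, Pi.single j 0⟩ := by
        cases C
        simp only [Instr.toTransition] at hs hz h0 hb
        simp only [hs, hz, CounterConfig.mk.injEq, true_and]
        funext i
        by_cases hi : i = j
        · subst hi; simpa using hb
        · simp [h0 i hi]
      refine ⟨[], z, rfl, ?_⟩
      cases z with
      | nil =>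
        rw [hz, inputTape_nil, List.cons.injEq] at htape
        simp only [Instr.toTransition] at htape
        obtain ⟨rfl, -⟩ := htape
        obtain ⟨rfl, rfl⟩ := hD.final _ _ _ _ hmem
        simpa [CheckerAccepts] using hmem
      | cons a' z =>
        rw [hz, inputTape_cons, List.cons.injEq] at htape
        simp only [Instr.toTransition] at htape
        obtain ⟨rfl, rfl⟩ := htape
        obtain ⟨-, rfl⟩ := hD.start _ _ _ _ hmem
        refine ⟨p, 0, 0, by simpa using hmem, by simp, ?_⟩
        have hp := hD.target _ _ _ _ _ hmem
        have hp2 := (hD.symbol _ _ _ _ _ hmem).2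
        have := checkerAccepts_of_accepts hpre hD hacc (q := p) (c := 0) (z := z) ?_ (by omega)
        · exact this.resolve_left (by tauto)
        · cases C'
          subst hC
          simp only [Instr.toTransition, Option.isSome_some, if_true] at hs' htape' hch
          simp only [hs', htape', CounterConfig.mk.injEq, true_and]
          funext i
          have := hch i
          by_cases hi : i = j
          · subst hi; simpa using this
          · simpa [hi] using this

end Machine

/-! ### Locating the position where the checker starts -/

/-- A nondeterministic choice of the position: the letters before it are skipped in state `0`. -/
def guessPosition (k L : ℕ) : List (CounterTransition k) :=
  (List.range L).map fun a => ⟨0, some a, fun _ => false, 0, true, 0⟩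

/-- A deterministic choice of the position: in state `1` the counter `i` is incremented on the
letter `0`, and the letter `1` leads to state `0`, in which the counter is decremented to zero. -/
def countPosition {k : ℕ} (i : Fin k) (L : ℕ) : List (CounterTransition k) :=
  [false, true].map (fun b =>
    ⟨1, some 0, Function.update (fun _ => false) i b, 1, true, Pi.single i 1⟩) ++
  [false, true].map (fun b =>
    ⟨1, some 1, Function.update (fun _ => false) i b, 0, true, 0⟩) ++
  (List.range L).map fun a =>
    ⟨0, some a, Function.update (fun _ => false) i true, 0, true, Pi.single i (-1)⟩

theorem mem_countPosition {k : ℕ} {i : Fin k} {L : ℕ} {t : CounterTransition k} :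
    t ∈ countPosition i L ↔
      (∃ b, t = ⟨1, some 0, Function.update (fun _ => false) i b, 1, true, Pi.single i 1⟩) ∨
      (∃ b, t = ⟨1, some 1, Function.update (fun _ => false) i b, 0, true, 0⟩) ∨
      ∃ a < L, t =
        ⟨0, some a, Function.update (fun _ => false) i true, 0, true, Pi.single i (-1)⟩ := by
  simp [countPosition, eq_comm, or_assoc]

theorem mem_guessPosition {k L : ℕ} {t : CounterTransition k} :
    t ∈ guessPosition k L ↔ ∃ a < L, t = ⟨0, some a, fun _ => false, 0, true, 0⟩ := by
  simp [guessPosition, eq_comm]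

theorem isLocator_guessPosition (k L : ℕ) : IsLocator (guessPosition k L) := by
  intro t ht
  obtain ⟨a, -, rfl⟩ := mem_guessPosition.1 ht
  simp

theorem isLocator_countPosition {k : ℕ} (i : Fin k) (L : ℕ) : IsLocator (countPosition i L) := by
  intro t ht
  rcases mem_countPosition.1 ht with ⟨b, rfl⟩ | ⟨b, rfl⟩ | ⟨a, -, rfl⟩ <;> simp

/-- The one-counter machine that guesses the position. -/
def guessMachine (L S : ℕ) (D : List Instr) : CounterMachine 1 :=
  checkerMachine 0 L S 0 (guessPosition 1 L) D

/-- The machine that determines the position with counter `i` and then works on counter `j`. -/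
def countMachine {k : ℕ} (i j : Fin k) (L S : ℕ) (D : List Instr) : CounterMachine k :=
  checkerMachine j L S 1 (countPosition i L) D

section Machine

variable {k : ℕ} {L S : ℕ} {D : List Instr}

theorem accepts_guessMachine {y z : List ℕ} (hy : ∀ a ∈ y, a < L) (h : CheckerAccepts D 0 0 z) :
    (guessMachine L S D).Accepts ⟨0, inputTape (y ++ z), fun _ => 0⟩ := by
  induction y with
  | nil =>
    have := accepts_of_checkerAccepts (j := (0 : Fin 1)) (L := L) (S := S) (start := 0)
      (pre := guessPosition 1 L) h
    rw [Pi.single_zero] at this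
    exact this
  | cons a y ih =>
    refine (ih fun b hb => hy b (by simp [hb])).step
      (t := ⟨0, some a, fun _ => false, 0, true, 0⟩)
      ⟨List.mem_append_left _ (mem_guessPosition.2 ⟨a, hy a (by simp), rfl⟩), rfl, rfl, ?_, ?_,
        _, rfl, rfl⟩
    · simp
    · simp

theorem accepts_countMachine_zero (i j : Fin k) {y z : List ℕ} (hy : ∀ a ∈ y, a < L)
    (h : CheckerAccepts D 0 0 z) :
    (countMachine i j L S D).Accepts ⟨0, inputTape (y ++ z), Pi.single i y.length⟩ := by
  induction y with
  | nil =>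
    have := accepts_of_checkerAccepts (j := j) (L := L) (S := S) (start := 1)
      (pre := countPosition i L) h
    rw [Pi.single_zero] at this
    rw [List.length_nil, Pi.single_zero]
    exact this
  | cons a y ih =>
    refine (ih fun b hb => hy b (by simp [hb])).step
      (t := ⟨0, some a, Function.update (fun _ => false) i true, 0, true, Pi.single i (-1)⟩)
      ⟨List.mem_append_left _ (mem_countPosition.2 (Or.inr (Or.inr ⟨a, hy a (by simp), rfl⟩))),
        rfl, rfl, ?_, ?_, _, rfl, rfl⟩
    · exact positive_update_iff.2 ⟨fun l hl => by simp [hl], by simp⟩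
    · intro l
      by_cases hl : l = i
      · subst hl; simp
      · simp [hl]

/-- The counter plus the number of zeros still to come is the length of the part that will be
skipped. -/
theorem accepts_countMachine_one (i j : Fin k) (m : ℕ) {y z : List ℕ}
    (hy : ∀ a ∈ y, a < L) (h : CheckerAccepts D 0 0 z) (n : ℕ) (hn : m + n = y.length) :
    (countMachine i j L S D).Accepts
      ⟨1, inputTape (List.replicate n 0 ++ 1 :: y ++ z), Pi.single i m⟩ := by
  induction n generalizing m with
  | zero =>
    obtain rfl : m = y.length := by simpa using hn
    refine (accepts_countMachine_zero i j hy h).step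
      (t := ⟨1, some 1, Function.update (fun _ => false) i (decide (0 < y.length)), 0, true, 0⟩)
      ⟨List.mem_append_left _ (mem_countPosition.2 (Or.inr (Or.inl ⟨_, rfl⟩))), rfl, rfl,
        ?_, ?_, _, rfl, rfl⟩
    · exact positive_update_iff.2 ⟨fun l hl => by simp [hl], by simp⟩
    · simp
  | succ n ih =>
    refine (ih (m + 1) (by omega)).step
      (t := ⟨1, some 0, Function.update (fun _ => false) i (decide (0 < m)), 1, true,
        Pi.single i 1⟩)
      ⟨List.mem_append_left _ (mem_countPosition.2 (Or.inl ⟨_, rfl⟩)), rfl, rfl,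
        ?_, ?_, _, rfl, rfl⟩
    · exact positive_update_iff.2 ⟨fun l hl => by simp [hl], by simp⟩
    · intro l
      by_cases hl : l = i
      · subst hl; simp
      · simp [hl]

/-! ### Suffix-density -/

theorem inputTape_map_val {n : ℕ} (w : List (Fin n)) :
    w.map (fun a : Fin n => some a.val) ++ [none] = inputTape (w.map Fin.val) := by
  simp [inputTape, List.map_map, Function.comp_def]

theorem exists_map_val {n : ℕ} {y : List ℕ} (hy : ∀ a ∈ y, a < n) :
    ∃ w : List (Fin n), w.map Fin.val = y := by
  induction y with
  | nil => exact ⟨[], rfl⟩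
  | cons a y ih =>
    obtain ⟨w, rfl⟩ := ih fun b hb => hy b (by simp [hb])
    exact ⟨⟨a, hy a (by simp)⟩ :: w, rfl⟩

theorem map_val_lt {n : ℕ} (w : List (Fin n)) : ∀ a ∈ w.map Fin.val, a < n := by
  intro a ha
  obtain ⟨b, -, rfl⟩ := List.mem_map.1 ha
  exact b.2

theorem CheckerAccepts.lt (hD : IsChecker L S D) {q c : ℕ} {z : List ℕ}
    (h : CheckerAccepts D q c z) : ∀ a ∈ z, a < L := by
  induction z generalizing q c with
  | nil => simp
  | cons a z ih =>
    obtain ⟨q', d, c', hmem, -, h⟩ := h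
    intro b hb
    rcases List.mem_cons.1 hb with rfl | hb
    · exact (hD.symbol _ _ _ _ _ hmem).1
    · exact ih h b hb

/-- Every word over the letters `0, …, L - 1` is comparable, as a suffix, with a word accepted by
the checker. -/
def IsCheckerDense (L : ℕ) (D : List Instr) : Prop :=
  ∀ w : List ℕ, (∀ a ∈ w, a < L) → ∃ z, CheckerAccepts D 0 0 z ∧ (z <:+ w ∨ w <:+ z)

/-- An accepted word ends with a word of the checker, and two suffixes of one word are comparable.
Conversely, the part of `w` before `z` is skipped as `y`; if instead `z` is longer than `w`, its
surplus is added to the left extension. -/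
theorem isDenseFor_suff_iff (hD : IsChecker L S D) {j : Fin k} {start : ℕ}
    {pre : List (CounterTransition k)} (hpre : IsLocator pre) (hstart : start ≤ 1)
    (hacc : ∀ y z, (∀ a ∈ y, a < L) → CheckerAccepts D 0 0 z → ∃ x : List ℕ, (∀ a ∈ x, a < L) ∧
      (checkerMachine j L S start pre D).Accepts ⟨start, inputTape (x ++ (y ++ z)), fun _ => 0⟩) :
    (checkerMachine j L S start pre D).language.IsDenseFor Language.suff ↔
      IsCheckerDense L D := by
  constructor
  · intro h w hw
    obtain ⟨w, rfl⟩ := exists_map_val hw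
    obtain ⟨x, hx⟩ := h w
    obtain ⟨y, z, hyz, hz⟩ := exists_checkerAccepts_of_accepts hpre hD
      (CounterMachine.mem_language.1 hx) (inputTape_map_val _) hstart
    refine ⟨z, hz, List.suffix_or_suffix_of_suffix ⟨y, hyz.symm⟩ ⟨x.map Fin.val, ?_⟩⟩
    exact (List.map_append (f := Fin.val) (l₁ := x) (l₂ := w)).symm
  · intro h w
    obtain ⟨z, hz, hzw⟩ := h (w.map Fin.val) (map_val_lt w)
    suffices ∃ x : List ℕ, (∀ a ∈ x, a < L) ∧ (checkerMachine j L S start pre D).Accepts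
        ⟨start, inputTape (x ++ w.map Fin.val), fun _ => 0⟩ by
      obtain ⟨x, hx, hacc⟩ := this
      obtain ⟨x, rfl⟩ := exists_map_val hx
      refine ⟨x, CounterMachine.mem_language.2 ?_⟩
      unfold CounterMachine.init
      rw [inputTape_map_val]
      exact (congrArg (fun v => (checkerMachine j L S start pre D).Accepts
        ⟨start, inputTape v, fun _ => 0⟩)
        (List.map_append (f := Fin.val) (l₁ := x) (l₂ := w))).mpr hacc
    rcases hzw with ⟨y, hy⟩ | ⟨y, hy⟩
    · obtain ⟨x, hx, hx'⟩ := hacc y z (fun a ha => map_val_lt w a (by rw [← hy]; simp [ha])) hz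
      exact ⟨x, hx, by rwa [← hy]⟩
    · obtain ⟨x, hx, hx'⟩ := hacc [] z (by simp) hz
      refine ⟨x ++ y, ?_, by rwa [List.append_assoc, hy]⟩
      intro a ha
      rcases List.mem_append.1 ha with ha | ha
      · exact hx a ha
      · exact CheckerAccepts.lt hD hz a (by rw [← hy]; simp [ha])

theorem isDenseFor_suff_guessMachine (hD : IsChecker L S D) :
    (guessMachine L S D).language.IsDenseFor Language.suff ↔ IsCheckerDense L D :=
  isDenseFor_suff_iff hD (isLocator_guessPosition 1 L) (Nat.zero_le _) fun y z hy hz =>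
    ⟨[], fun _ h => absurd h List.not_mem_nil, accepts_guessMachine (y := y) (z := z) hy hz⟩

theorem isDenseFor_suff_countMachine (hD : IsChecker L S D) (i j : Fin k) :
    (countMachine i j L S D).language.IsDenseFor Language.suff ↔ IsCheckerDense L D := by
  refine isDenseFor_suff_iff hD (isLocator_countPosition i L) le_rfl fun y z hy hz =>
    -- The left extension announces the number of letters to be skipped.
    ⟨List.replicate y.length 0 ++ [1], ?_, ?_⟩
  · have := hD.two_le
    intro a ha
    simp only [List.mem_append, List.mem_replicate, List.mem_singleton] at ha
    omega
  · have := accepts_countMachine_one (S := S) i j 0 hy hz y.length (by simp)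
    rw [Pi.single_zero] at this
    rw [show List.replicate y.length 0 ++ [1] ++ (y ++ z) =
      List.replicate y.length 0 ++ 1 :: y ++ z by simp]
    exact this

/-! ### The machines belong to the classes -/

theorem wellFormed_checkerMachine (hD : IsChecker L S D) {j : Fin k} {start : ℕ}
    {pre : List (CounterTransition k)} (hpre : IsLocator pre) (hstart : start ≤ 1)
    (hsymbol : ∀ t ∈ pre, ∀ a ∈ t.symbol, a < L)
    (hchange : ∀ t ∈ pre, ∀ i, t.positive i = false → 0 ≤ t.change i) :
    (checkerMachine j L S start pre D).WellFormed := by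
  have h3 := hD.three_le
  constructor
  · simp only [checkerMachine]; omega
  · simp only [checkerMachine, List.mem_singleton]; rintro q rfl; omega
  · intro t ht
    rcases List.mem_append.1 ht with ht | ht
    · have := (hpre t ht).1
      simp only [checkerMachine]; omega
    · obtain ⟨⟨q, a, b, p, d⟩, hmem, rfl⟩ := List.mem_map.1 ht
      exact (hD.source _ _ _ _ _ hmem).2.2
  · intro t ht
    rcases List.mem_append.1 ht with ht | ht
    · have := (hpre t ht).2.1
      simp only [checkerMachine]; omega
    · obtain ⟨⟨q, a, b, p, d⟩, hmem, rfl⟩ := List.mem_map.1 ht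
      exact (hD.target _ _ _ _ _ hmem).2.2
  · intro t ht
    rcases List.mem_append.1 ht with ht | ht
    · exact hsymbol t ht
    · obtain ⟨⟨q, a, b, p, d⟩, hmem, rfl⟩ := List.mem_map.1 ht
      rintro a' ha'
      obtain rfl : a = some a' := ha'
      exact (hD.symbol _ _ _ _ _ hmem).1
  · intro t ht
    rcases List.mem_append.1 ht with ht | ht
    · exact hchange t ht
    · obtain ⟨⟨q, a, b, p, d⟩, hmem, rfl⟩ := List.mem_map.1 ht
      intro i hi
      by_cases hij : i = j
      · subst hij
        simp only [Instr.toTransition, Function.update_self] at hi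
        subst hi
        simpa [Instr.toTransition] using hD.nonneg _ _ _ _ hmem
      · simp [Instr.toTransition, hij]

theorem guessMachine_mem_NCM (hD : IsChecker L S D) : guessMachine L S D ∈ NCM 1 1 := by
  refine ⟨wellFormed_checkerMachine hD (isLocator_guessPosition 1 L) (Nat.zero_le _) ?_ ?_, ?_⟩
  · intro t ht
    obtain ⟨a, ha, rfl⟩ := mem_guessPosition.1 ht
    simpa using ha
  · intro t ht
    obtain ⟨a, ha, rfl⟩ := mem_guessPosition.1 ht
    simp
  · obtain ⟨phase, hle, hph⟩ := hD.phase
    refine CounterMachine.reversalBounded_of_phase (fun _ => phase) (fun _ => hle) ?_ ?_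
    · intro i t ht
      rcases List.mem_append.1 ht with ht | ht
      · obtain ⟨a, ha, rfl⟩ := mem_guessPosition.1 ht
        simp
      · obtain ⟨⟨q, a, b, p, d⟩, hmem, rfl⟩ := List.mem_map.1 ht
        exact (hph _ _ _ _ _ hmem).1
    · intro i t ht
      rcases List.mem_append.1 ht with ht | ht
      · obtain ⟨a, ha, rfl⟩ := mem_guessPosition.1 ht
        simp [CounterMachine.PhaseAgrees]
      · obtain ⟨⟨q, a, b, p, d⟩, hmem, rfl⟩ := List.mem_map.1 ht
        obtain rfl : i = 0 := Subsingleton.elim _ _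
        simpa [Instr.toTransition] using (hph _ _ _ _ _ hmem).2

/-- The two parts share only the state `0` as a source. There the locating part needs counter `i` to
be positive, while an instruction needs all counters to be zero by the condition `start`. -/
theorem deterministic_countMachine (hD : IsChecker L S D) (i j : Fin k) :
    (countMachine i j L S D).Deterministic := by
  have hcross : ∀ t ∈ countPosition i L, ∀ r ∈ D, t.source = (r.toTransition j).source →
      t.positive ≠ (r.toTransition j).positive := by
    rintro t ht ⟨q, a, b, p, d⟩ hr hs hp
    have h1 := (hD.source _ _ _ _ _ hr).1
    rcases mem_countPosition.1 ht with ⟨b', rfl⟩ | ⟨b', rfl⟩ | ⟨a, -, rfl⟩ <;>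
      simp only [Instr.toTransition] at hs hp
    · exact h1 hs.symm
    · exact h1 hs.symm
    · subst hs
      obtain ⟨rfl, -⟩ := hD.start _ _ _ _ hr
      have := congrFun hp i
      by_cases hij : i = j
      · subst hij; simp at this
      · simp [hij] at this
  intro t ht t' ht' hs ha hp
  rcases List.mem_append.1 ht with ht | ht <;> rcases List.mem_append.1 ht' with ht' | ht'
  · have hp' := congrFun hp i
    rcases mem_countPosition.1 ht with ⟨b, rfl⟩ | ⟨b, rfl⟩ | ⟨a, -, rfl⟩ <;>
      rcases mem_countPosition.1 ht' with ⟨b', rfl⟩ | ⟨b', rfl⟩ | ⟨a', -, rfl⟩ <;>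
      simp_all
  · obtain ⟨r, hr, rfl⟩ := List.mem_map.1 ht'
    exact absurd hp (hcross t ht r hr hs)
  · obtain ⟨r, hr, rfl⟩ := List.mem_map.1 ht
    exact absurd hp.symm (hcross t' ht' r hr hs.symm)
  · obtain ⟨⟨q, a, b, p, d⟩, hr, rfl⟩ := List.mem_map.1 ht
    obtain ⟨⟨q', a', b', p', d'⟩, hr', rfl⟩ := List.mem_map.1 ht'
    simp only [Instr.toTransition] at hs ha hp
    have hb := congrFun hp j
    simp only [Function.update_self] at hb
    subst hs ha hb
    obtain ⟨rfl, rfl⟩ := hD.det _ _ _ _ _ _ _ hr hr'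
    rfl

theorem wellFormed_countMachine (hD : IsChecker L S D) (i j : Fin k) :
    (countMachine i j L S D).WellFormed := by
  have h2 := hD.two_le
  refine wellFormed_checkerMachine hD (isLocator_countPosition i L) le_rfl ?_ ?_
  · intro t ht
    rcases mem_countPosition.1 ht with ⟨b, rfl⟩ | ⟨b, rfl⟩ | ⟨a, ha, rfl⟩
    · rintro _ ⟨⟩; omega
    · rintro _ ⟨⟩; omega
    · rintro _ ⟨⟩; exact ha
  · intro t ht l hl
    rcases mem_countPosition.1 ht with ⟨b, rfl⟩ | ⟨b, rfl⟩ | ⟨a, ha, rfl⟩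
    · by_cases h : l = i
      · subst h; simp
      · simp [h]
    · simp
    · by_cases h : l = i
      · subst h; simp at hl
      · simp [h]

/-- The counter rises in state `1`, falls in state `0`, then may rise and fall once more in the
checker: phases `0` to `3`. -/
theorem countMachine_mem_DCM_one (hD : IsChecker L S D) :
    countMachine (0 : Fin 1) 0 L S D ∈ DCM 1 3 := by
  refine ⟨wellFormed_countMachine hD 0 0, deterministic_countMachine hD 0 0, ?_⟩
  obtain ⟨phase, hle, hph⟩ := hD.phase
  refine CounterMachine.reversalBounded_of_phase
    (fun _ q => if q = 1 then 0 else if q = 0 then 1 else 2 + phase q) ?_ ?_ ?_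
  · intro i q
    have := hle q
    split_ifs <;> omega
  · intro i t ht
    rcases List.mem_append.1 ht with ht | ht
    · rcases mem_countPosition.1 ht with ⟨b, rfl⟩ | ⟨b, rfl⟩ | ⟨a, ha, rfl⟩ <;> simp
    · obtain ⟨⟨q, a, b, p, d⟩, hmem, rfl⟩ := List.mem_map.1 ht
      have h1 := (hph _ _ _ _ _ hmem).1
      have h2 := hD.source _ _ _ _ _ hmem
      have h3 := hD.target _ _ _ _ _ hmem
      change (if q = 1 then 0 else if q = 0 then 1 else 2 + phase q) ≤
        if p = 1 then 0 else if p = 0 then 1 else 2 + phase p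
      rw [if_neg h2.1, if_neg h3.1, if_neg h3.2.1]
      split_ifs <;> omega
  · intro i t ht
    obtain rfl : i = 0 := Subsingleton.elim _ _
    rcases List.mem_append.1 ht with ht | ht
    · rcases mem_countPosition.1 ht with ⟨b, rfl⟩ | ⟨b, rfl⟩ | ⟨a, ha, rfl⟩ <;>
        simp [CounterMachine.PhaseAgrees]
    · obtain ⟨⟨q, a, b, p, d⟩, hmem, rfl⟩ := List.mem_map.1 ht
      have h1 := (hph _ _ _ _ _ hmem).2
      have h2 := hD.source _ _ _ _ _ hmem
      simp only [Instr.toTransition, Pi.single_eq_same]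
      by_cases hq : q = 0
      · subst hq
        obtain ⟨-, rfl⟩ := hD.start _ _ _ _ hmem
        simp [CounterMachine.PhaseAgrees]
      · simpa [CounterMachine.PhaseAgrees, hq, h2.1] using h1

/-- Counter `0` locates and counter `1` checks, so each of them reverses at most once. -/
theorem countMachine_mem_DCM_two (hD : IsChecker L S D) :
    countMachine (0 : Fin 2) 1 L S D ∈ DCM 2 1 := by
  refine ⟨wellFormed_countMachine hD 0 1, deterministic_countMachine hD 0 1, ?_⟩
  obtain ⟨phase, hle, hph⟩ := hD.phase
  refine CounterMachine.reversalBounded_of_phase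
    ![fun q => if q = 1 then 0 else 1, fun q => if q ≤ 1 then 0 else phase q] ?_ ?_ ?_
  · intro i q
    have := hle q
    fin_cases i <;> simp <;> split_ifs <;> omega
  · intro i t ht
    rcases List.mem_append.1 ht with ht | ht
    · rcases mem_countPosition.1 ht with ⟨b, rfl⟩ | ⟨b, rfl⟩ | ⟨a, ha, rfl⟩ <;>
        fin_cases i <;> simp
    · obtain ⟨⟨q, a, b, p, d⟩, hmem, rfl⟩ := List.mem_map.1 ht
      have h1 := (hph _ _ _ _ _ hmem).1
      have h2 := hD.source _ _ _ _ _ hmem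
      have h3 := hD.target _ _ _ _ _ hmem
      fin_cases i <;> simp [Instr.toTransition] <;> split_ifs <;> omega
  · intro i t ht
    rcases List.mem_append.1 ht with ht | ht
    · rcases mem_countPosition.1 ht with ⟨b, rfl⟩ | ⟨b, rfl⟩ | ⟨a, ha, rfl⟩ <;>
        fin_cases i <;> simp [CounterMachine.PhaseAgrees]
    · obtain ⟨⟨q, a, b, p, d⟩, hmem, rfl⟩ := List.mem_map.1 ht
      have h1 := (hph _ _ _ _ _ hmem).2
      have h2 := hD.source _ _ _ _ _ hmem
      fin_cases i
      · simp [CounterMachine.PhaseAgrees, Instr.toTransition]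
      · by_cases hq : q = 0
        · subst hq
          obtain ⟨-, rfl⟩ := hD.start _ _ _ _ hmem
          simp [CounterMachine.PhaseAgrees, Instr.toTransition]
        · have : ¬ q ≤ 1 := by omega
          simpa [CounterMachine.PhaseAgrees, Instr.toTransition, this] using h1

end Machine

/-! ### Block systems and their histories -/

/-- A system of local conditions on sequences of blocks `(ℓ, c)` of a label `ℓ` and a number `c`.
The label of a block determines a residue of its number and a linear relation between its
number and that of the block `skipped + 1` places later. -/
structure BlockSystem where
  numLabels : ℕ
  skipped : ℕ
  inMod : ℕ → ℕ
  inRem : ℕ → ℕ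
  outMod : ℕ → ℕ
  outRem : ℕ → ℕ
  next : ℕ → ℕ → Bool
  final : ℕ → Bool
  inMod_pos : ∀ l, 0 < inMod l
  outMod_pos : ∀ l, 0 < outMod l

namespace BlockSystem

/-- The local condition on a block `b` and the blocks after it. -/
def LocallyValid (B : BlockSystem) (b : ℕ × ℕ) (rest : List (ℕ × ℕ)) : Prop :=
  b.2 % B.inMod b.1 = B.inRem b.1 ∧
  (∀ b' ∈ rest.head?, B.next b.1 b'.1 = true) ∧
  (rest = [] → B.final b.1 = true) ∧
  ∀ b' ∈ rest[B.skipped]?,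
    b'.2 % B.outMod b.1 = B.outRem b.1 ∧ b'.2 / B.outMod b.1 = b.2 / B.inMod b.1

/-- The local conditions hold for all blocks of a list. -/
def Valid (B : BlockSystem) : List (ℕ × ℕ) → Prop
  | [] => True
  | b :: rest => b.1 < B.numLabels ∧ B.LocallyValid b rest ∧ B.Valid rest

/-- The word that describes a list of blocks: the block `(ℓ, c)` is the letter `ℓ + 2` followed
by `c` letters `0`. -/
def word : List (ℕ × ℕ) → List ℕ
  | [] => []
  | b :: bs => (b.1 + 2) :: (List.replicate b.2 0 ++ word bs)

theorem word_append (bs bs' : List (ℕ × ℕ)) : word (bs ++ bs') = word bs ++ word bs' := by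
  induction bs with
  | nil => rfl
  | cons b bs ih => simp [word, ih]

theorem head?_word (bs : List (ℕ × ℕ)) : (word bs).head? ≠ some 0 := by
  cases bs <;> simp [word]

theorem one_notMem_word (bs : List (ℕ × ℕ)) : 1 ∉ word bs := by
  induction bs with
  | nil => simp [word]
  | cons b bs ih => simp [word, ih]

theorem lt_of_mem_word {n : ℕ} {bs : List (ℕ × ℕ)} :
    (∀ a ∈ word bs, a < n + 2) ↔ ∀ b ∈ bs, b.1 < n := by
  induction bs with
  | nil => simp [word]
  | cons b bs ih =>
    simp only [word, List.mem_cons, List.mem_append, List.mem_replicate, forall_eq_or_imp]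
    constructor
    · rintro ⟨h1, h2⟩
      exact ⟨by omega, ih.1 fun a ha => h2 a (Or.inr ha)⟩
    · rintro ⟨h1, h2⟩
      refine ⟨by omega, ?_⟩
      rintro a (⟨-, rfl⟩ | ha)
      · omega
      · exact ih.2 h2 a ha

/-- Every letter other than `0` and `1` opens a block, so a word without `1` is the rest of a cut
block followed by whole blocks. -/
theorem exists_eq_replicate_append_word {z : List ℕ} (hz : 1 ∉ z) :
    ∃ c bs, z = List.replicate c 0 ++ word bs := by
  induction z with
  | nil => exact ⟨0, [], rfl⟩
  | cons a z ih =>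
    obtain ⟨c, bs, rfl⟩ := ih fun h => hz (by simp [h])
    match a with
    | 0 => exact ⟨c + 1, bs, rfl⟩
    | 1 => simp at hz
    | l + 2 => exact ⟨0, (l, c) :: bs, rfl⟩

theorem exists_eq_word {z : List ℕ} (hz : 1 ∉ z) (h0 : z.head? ≠ some 0) :
    ∃ bs, z = word bs := by
  obtain ⟨c, bs, rfl⟩ := exists_eq_replicate_append_word hz
  cases c with
  | zero => exact ⟨bs, rfl⟩
  | succ c => simp [List.replicate_succ] at h0

end BlockSystem

/-! ### The local checker -/

/-- The states of the checker of the local condition at a block with label `l`. -/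
inductive CheckState
  /-- a violation was found -/
  | ok
  /-- reading the number of the block, its residue so far being `i` -/
  | scan (l i : ℕ)
  /-- skipping the next `g + 1` labels -/
  | skip (l g : ℕ)
  /-- comparing with the number of a later block, its residue so far being `i` -/
  | comp (l i : ℕ)

namespace CheckState

/-- The number of a state. -/
def num : CheckState → ℕ
  | ok => 3
  | scan l i => 4 + 3 * Nat.pair l i
  | skip l g => 5 + 3 * Nat.pair l g
  | comp l i => 6 + 3 * Nat.pair l i

theorem num_injective : Function.Injective num := by
  intro s s' h
  cases s <;> cases s' <;> simp only [num] at h <;>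
    first | omega | rfl | simpa [Nat.pair_eq_pair] using h

theorem three_le_num (s : CheckState) : 3 ≤ s.num := by
  cases s <;> simp only [num] <;> omega

end CheckState

namespace BlockSystem

open CheckState

variable (B : BlockSystem)

/-- The state after which `g` more labels are skipped before the comparison. -/
def seek (l : ℕ) : ℕ → CheckState
  | 0 => comp l 0
  | g + 1 => skip l g

/-- One step of the checker, on a letter and the sign of the counter. The letter `1` separates
histories and must not be read. -/
def step : CheckState → ℕ → Bool → Option (CheckState × SignType)
  | _, 1, _ => none
  | ok, _, _ => some (ok, 0)
  | scan l i, 0, _ =>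
    if i + 1 = B.inMod l then some (scan l 0, 1) else some (scan l (i + 1), 0)
  | scan l i, l' + 2, _ =>
    if i = B.inRem l ∧ B.next l l' = true then some (seek l B.skipped, 0) else some (ok, 0)
  | skip l g, 0, _ => some (skip l g, 0)
  | skip l g, _ + 2, _ => some (seek l g, 0)
  | comp l i, 0, b =>
    if i + 1 = B.outMod l then (if b then some (comp l 0, -1) else some (ok, 0))
    else some (comp l (i + 1), 0)
  | comp l i, _ + 2, b => if i = B.outRem l ∧ b = false then none else some (ok, 0)

/-- Acceptance at the end of the input. -/
def accept : CheckState → Bool → Bool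
  | ok, _ => true
  | scan l i, _ => !(decide (i = B.inRem l) && B.final l)
  | skip _ _, _ => false
  | comp l i, b => !(decide (i = B.outRem l) && !b)

/-- The checker accepts from a state with a given value of the counter. -/
def Detects : CheckState → ℕ → List ℕ → Prop
  | s, c, [] => B.accept s (decide (0 < c)) = true
  | s, c, a :: z => ∃ s' d, ∃ c' : ℕ, B.step s a (decide (0 < c)) = some (s', d) ∧
      (c' : ℤ) = (c : ℤ) + (d : ℤ) ∧ Detects s' c' z

variable {B}

theorem step_one (s : CheckState) (b : Bool) : B.step s 1 b = none := by
  cases s <;> rfl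

theorem Detects.one_notMem {s : CheckState} {c : ℕ} {z : List ℕ} (h : B.Detects s c z) :
    1 ∉ z := by
  induction z generalizing s c with
  | nil => simp
  | cons a z ih =>
    obtain ⟨s', d, c', h1, -, h2⟩ := h
    intro hmem
    rcases List.mem_cons.1 hmem with rfl | hmem
    · simp [step_one] at h1
    · exact ih h2 hmem

theorem detects_cons_zero {s s' : CheckState} {c a : ℕ} {z : List ℕ}
    (h : B.step s a (decide (0 < c)) = some (s', 0)) :
    B.Detects s c (a :: z) ↔ B.Detects s' c z := by
  simp [Detects, h]

theorem detects_cons_one {s s' : CheckState} {c a : ℕ} {z : List ℕ}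
    (h : B.step s a (decide (0 < c)) = some (s', 1)) :
    B.Detects s c (a :: z) ↔ B.Detects s' (c + 1) z := by
  simp only [Detects, h, Option.some.injEq, Prod.mk.injEq]
  constructor
  · rintro ⟨_, _, c', ⟨rfl, rfl⟩, hc, hz⟩
    obtain rfl : c' = c + 1 := by
      simp at hc
      omega
    exact hz
  · intro hz
    exact ⟨_, _, c + 1, ⟨rfl, rfl⟩, by simp, hz⟩

theorem detects_cons_neg_one {s s' : CheckState} {c a : ℕ} {z : List ℕ}
    (h : B.step s a (decide (0 < c + 1)) = some (s', -1)) :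
    B.Detects s (c + 1) (a :: z) ↔ B.Detects s' c z := by
  simp only [Detects, h, Option.some.injEq, Prod.mk.injEq]
  constructor
  · rintro ⟨_, _, c', ⟨rfl, rfl⟩, hc, hz⟩
    obtain rfl : c' = c := by
      simp at hc
      exact hc
    exact hz
  · intro hz
    exact ⟨_, _, c, ⟨rfl, rfl⟩, by simp, hz⟩

theorem detects_ok {c : ℕ} {z : List ℕ} : B.Detects ok c z ↔ 1 ∉ z := by
  refine ⟨Detects.one_notMem, fun h => ?_⟩
  induction z with
  | nil => rfl
  | cons a z ih =>
    match a with
    | 0 => exact (detects_cons_zero rfl).2 (ih fun h' => h (by simp [h']))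
    | 1 => simp at h
    | l + 2 => exact (detects_cons_zero rfl).2 (ih fun h' => h (by simp [h']))

theorem one_notMem_replicate_append_word (c : ℕ) (bs : List (ℕ × ℕ)) :
    1 ∉ List.replicate c 0 ++ word bs := by
  simp [one_notMem_word, List.mem_replicate]

/-- The counter holds the expected quotient and loses one for every `outMod l` letters `0`. A
mismatch shows up as a decrement due at zero, as a positive counter at the end of the block, or as a
wrong residue. -/
theorem detects_comp {l : ℕ} {bs : List (ℕ × ℕ)} {c : ℕ} : ∀ {i k : ℕ}, i < B.outMod l →
    (B.Detects (comp l i) k (List.replicate c 0 ++ word bs) ↔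
      ¬ ((i + c) % B.outMod l = B.outRem l ∧ (i + c) / B.outMod l = k)) := by
  have hpos := B.outMod_pos l
  induction c with
  | zero =>
    intro i k hi
    rw [Nat.add_zero, Nat.mod_eq_of_lt hi, Nat.div_eq_of_lt hi]
    cases bs with
    | nil =>
      simp only [List.replicate_zero, List.nil_append, word, Detects, accept]
      cases k <;> simp
    | cons b bs =>
      simp only [List.replicate_zero, List.nil_append, word]
      by_cases h : i = B.outRem l ∧ k = 0
      · obtain ⟨h1, rfl⟩ := h
        simp [Detects, step, h1]
      · have hk : ¬ (i = B.outRem l ∧ decide (0 < k) = false) := by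
          simpa using h
        rw [detects_cons_zero (s' := ok) (by simp only [step, if_neg hk]), detects_ok]
        refine iff_of_true (one_notMem_replicate_append_word _ _) ?_
        rintro ⟨h1, h2⟩
        exact h ⟨h1, h2.symm⟩
  | succ c ih =>
    intro i k hi
    rw [List.replicate_succ, List.cons_append]
    by_cases hi1 : i + 1 = B.outMod l
    · have e : i + (c + 1) = c + B.outMod l := by omega
      rw [e, Nat.add_mod_right, Nat.add_div_right _ hpos]
      cases k with
      | zero =>
        rw [detects_cons_zero (s' := ok) (by simp [step, hi1]), detects_ok]
        exact iff_of_true (one_notMem_replicate_append_word _ _) (by simp)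
      | succ k =>
        rw [detects_cons_neg_one (s' := comp l 0) (by simp [step, hi1]), ih hpos]
        simp
    · rw [detects_cons_zero (s' := comp l (i + 1)) (by simp [step, hi1]), ih (by omega),
        show i + 1 + c = i + (c + 1) by omega]

/-- Here `b` is the block whose label has just been read. A `skip` state rejects at the end of the
input, since `LocallyValid` demands nothing of a missing block. -/
theorem detects_seek {l g k : ℕ} {b : ℕ × ℕ} {bs : List (ℕ × ℕ)} :
    B.Detects (seek l g) k (List.replicate b.2 0 ++ word bs) ↔
      ∃ b' ∈ (b :: bs)[g]?, ¬ (b'.2 % B.outMod l = B.outRem l ∧ b'.2 / B.outMod l = k) := by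
  induction g generalizing b bs with
  | zero =>
    rw [seek, detects_comp (B.outMod_pos l)]
    simp
  | succ g ih =>
    rw [seek]
    -- The zeros of a skipped block do not matter, so their number may vary in an induction.
    suffices h : ∀ c, B.Detects (skip l g) k (List.replicate c 0 ++ word bs) ↔
        ∃ b' ∈ bs[g]?, ¬ (b'.2 % B.outMod l = B.outRem l ∧ b'.2 / B.outMod l = k) by
      simpa using h b.2
    intro c
    induction c with
    | zero =>
      cases bs with
      | nil => simp [word, Detects, accept]
      | cons b' bs =>
        simp only [List.replicate_zero, List.nil_append, word]
        rw [detects_cons_zero (s' := seek l g) (by simp [step]), ih]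
    | succ c ihc =>
      rw [List.replicate_succ, List.cons_append,
        detects_cons_zero (s' := skip l g) (by simp [step]), ihc]

/-- Here `k` counts the completed groups of `inMod l` zeros, so at the end of the block the counter
holds the quotient to be compared. A wrong residue or a wrong next label leads to acceptance at
once; otherwise `detects_seek` takes over. -/
theorem detects_read {l c : ℕ} {bs : List (ℕ × ℕ)} : ∀ {i k : ℕ}, i < B.inMod l →
    (B.Detects (scan l i) k (List.replicate c 0 ++ word bs) ↔
      ¬ ((i + c) % B.inMod l = B.inRem l ∧ (∀ b' ∈ bs.head?, B.next l b'.1 = true) ∧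
        (bs = [] → B.final l = true) ∧
        ∀ b' ∈ bs[B.skipped]?, b'.2 % B.outMod l = B.outRem l ∧
          b'.2 / B.outMod l = k + (i + c) / B.inMod l)) := by
  have hpos := B.inMod_pos l
  induction c with
  | zero =>
    intro i k hi
    rw [Nat.add_zero, Nat.mod_eq_of_lt hi, Nat.div_eq_of_lt hi]
    cases bs with
    | nil => simp [word, Detects, accept, imp_iff_not_or]
    | cons b bs =>
      simp only [List.replicate_zero, List.nil_append, word]
      by_cases h : i = B.inRem l ∧ B.next l b.1 = true
      · rw [detects_cons_zero (s' := seek l B.skipped) (by simp only [step, if_pos h]),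
          detects_seek]
        simp [h.1, h.2]
      · rw [detects_cons_zero (s' := ok) (by simp only [step, if_neg h]), detects_ok]
        refine iff_of_true (one_notMem_replicate_append_word _ _) ?_
        rintro ⟨h1, h2, -⟩
        exact h ⟨h1, h2 b rfl⟩
  | succ c ih =>
    intro i k hi
    rw [List.replicate_succ, List.cons_append]
    by_cases hi1 : i + 1 = B.inMod l
    · have e : i + (c + 1) = c + B.inMod l := by omega
      rw [e, Nat.add_mod_right, Nat.add_div_right _ hpos,
        detects_cons_one (s' := scan l 0) (by simp [step, hi1]), ih hpos, Nat.zero_add,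
        show k + 1 + c / B.inMod l = k + (c / B.inMod l).succ by omega]
    · rw [detects_cons_zero (s' := scan l (i + 1)) (by simp [step, hi1]), ih (by omega),
        show i + 1 + c = i + (c + 1) by omega]

theorem detects_read_iff {b : ℕ × ℕ} {bs : List (ℕ × ℕ)} :
    B.Detects (scan b.1 0) 0 (List.replicate b.2 0 ++ word bs) ↔ ¬ B.LocallyValid b bs := by
  rw [detects_read (B.inMod_pos _), LocallyValid]
  simp only [Nat.zero_add]

/-! ### The checker as a list of instructions -/

variable (B)

/-- The number of letters. -/
def numLetters : ℕ := B.numLabels + 2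

/-- The states of the local checker. -/
def states : List CheckState :=
  [ok] ++
  (List.range B.numLabels).flatMap (fun l => (List.range (B.inMod l)).map (scan l)) ++
  (List.range B.numLabels).flatMap (fun l => (List.range B.skipped).map (skip l)) ++
  (List.range B.numLabels).flatMap (fun l => (List.range (B.outMod l)).map (comp l))

/-- A strict upper bound for the numbers of the states of the local checker. -/
def base : ℕ := (B.states.map num).sum + 1

/-- The instructions of the local checker. -/
def localInstrs : List Instr :=
  B.states.flatMap fun s =>
    ((List.range B.numLetters).flatMap fun a => [false, true].flatMap fun b =>
      (B.step s a b).toList.map fun p => (s.num, some a, b, p.1.num, p.2)) ++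
    ([false, true].filter (B.accept s)).map fun b => (s.num, none, b, 2, 0)

/-- The instructions that start the checker. -/
def startInstrs : List Instr :=
  (0, some 1, false, B.base, 0) ::
    (List.range B.numLabels).map fun l => (0, some (l + 2), false, (scan l 0).num, 0)

/-- The instruction that compares a letter with the letter `i` of the initial word `u`. -/
def compareInstr (u : List ℕ) (i a : ℕ) : Instr :=
  (B.base + i, some a, false, if a = u.getD i 0 then B.base + i + 1 else 3, 0)

/-- The instructions that compare the first letters of a history with the initial word `u`. -/
def prefixInstrs (u : List ℕ) : List Instr :=
  ((List.range u.length).flatMap fun i =>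
    (B.base + i, none, false, 2, 0) ::
      (0 :: (List.range B.numLabels).map fun l => l + 2).map (B.compareInstr u i)) ++
  [(B.base + u.length, some 0, false, 3, 0)]

/-- The checker for histories that begin with the word `u`. -/
def instrs (u : List ℕ) : List Instr :=
  (B.startInstrs ++ B.localInstrs) ++ B.prefixInstrs u

variable {B}

theorem mem_states {s : CheckState} : s ∈ B.states ↔ s = ok ∨
    (∃ l < B.numLabels, ∃ i < B.inMod l, s = scan l i) ∨
    (∃ l < B.numLabels, ∃ g < B.skipped, s = skip l g) ∨
    ∃ l < B.numLabels, ∃ i < B.outMod l, s = comp l i := by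
  simp only [states, List.mem_append, List.mem_singleton, List.mem_flatMap, List.mem_range,
    List.mem_map, or_assoc, eq_comm]

theorem num_lt_base {s : CheckState} (hs : s ∈ B.states) : s.num < B.base :=
  Nat.lt_succ_of_le (List.le_sum_of_mem (List.mem_map_of_mem hs))

theorem three_lt_base : 3 < B.base :=
  num_lt_base (s := ok) (mem_states.2 (Or.inl rfl))

theorem seek_mem_states {l g : ℕ} (hl : l < B.numLabels) (hg : g ≤ B.skipped) :
    seek l g ∈ B.states := by
  cases g with
  | zero => exact mem_states.2 (Or.inr (Or.inr (Or.inr ⟨l, hl, 0, B.outMod_pos l, rfl⟩)))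
  | succ g => exact mem_states.2 (Or.inr (Or.inr (Or.inl ⟨l, hl, g, hg, rfl⟩)))

/-- A classification of the steps from which closure of the state set, the sign conditions and the
phases are all read off. -/
theorem step_eq_some {s s' : CheckState} {a : ℕ} {b : Bool} {d : SignType}
    (h : B.step s a b = some (s', d)) :
    (s' = ok ∧ d = 0) ∨
    (∃ l i j, s = scan l i ∧ s' = scan l j ∧ (i < B.inMod l → j < B.inMod l) ∧
      (d = 0 ∨ d = 1)) ∨
    (∃ l i, s = scan l i ∧ s' = seek l B.skipped ∧ d = 0) ∨
    (∃ l g, s = skip l g ∧ (s' = skip l g ∨ s' = seek l g) ∧ d = 0) ∨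
    (∃ l i j, s = comp l i ∧ s' = comp l j ∧ (i < B.outMod l → j < B.outMod l) ∧
      (d = 0 ∨ d = -1 ∧ b = true)) := by
  match s, a with
  | _, 1 => simp [step_one] at h
  | ok, 0 => simp [step] at h; exact Or.inl ⟨h.1.symm, h.2.symm⟩
  | ok, l' + 2 => simp [step] at h; exact Or.inl ⟨h.1.symm, h.2.symm⟩
  | scan l i, 0 =>
    simp only [step] at h
    split_ifs at h <;> simp only [Option.some.injEq, Prod.mk.injEq] at h
    · exact Or.inr (Or.inl ⟨l, i, 0, rfl, h.1.symm, fun _ => B.inMod_pos l, Or.inr h.2.symm⟩)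
    · exact Or.inr (Or.inl ⟨l, i, i + 1, rfl, h.1.symm, fun _ => by omega, Or.inl h.2.symm⟩)
  | scan l i, l' + 2 =>
    simp only [step] at h
    split_ifs at h <;> simp only [Option.some.injEq, Prod.mk.injEq] at h
    · exact Or.inr (Or.inr (Or.inl ⟨l, i, rfl, h.1.symm, h.2.symm⟩))
    · exact Or.inl ⟨h.1.symm, h.2.symm⟩
  | skip l g, 0 =>
    simp only [step, Option.some.injEq, Prod.mk.injEq] at h
    exact Or.inr (Or.inr (Or.inr (Or.inl ⟨l, g, rfl, Or.inl h.1.symm, h.2.symm⟩)))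
  | skip l g, l' + 2 =>
    simp only [step, Option.some.injEq, Prod.mk.injEq] at h
    exact Or.inr (Or.inr (Or.inr (Or.inl ⟨l, g, rfl, Or.inr h.1.symm, h.2.symm⟩)))
  | comp l i, 0 =>
    simp only [step] at h
    split_ifs at h with h1 h2 <;> simp only [Option.some.injEq, Prod.mk.injEq] at h
    · exact Or.inr (Or.inr (Or.inr (Or.inr
        ⟨l, i, 0, rfl, h.1.symm, fun _ => B.outMod_pos l, Or.inr ⟨h.2.symm, h2⟩⟩)))
    · exact Or.inl ⟨h.1.symm, h.2.symm⟩
    · exact Or.inr (Or.inr (Or.inr (Or.inr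
        ⟨l, i, i + 1, rfl, h.1.symm, fun _ => by omega, Or.inl h.2.symm⟩)))
  | comp l i, l' + 2 =>
    simp only [step] at h
    split_ifs at h
    simp only [Option.some.injEq, Prod.mk.injEq] at h
    exact Or.inl ⟨h.1.symm, h.2.symm⟩

theorem mem_states_iff {s : CheckState} : s ∈ B.states ↔ match s with
    | ok => True
    | scan l i => l < B.numLabels ∧ i < B.inMod l
    | skip l g => l < B.numLabels ∧ g < B.skipped
    | comp l i => l < B.numLabels ∧ i < B.outMod l := by
  rw [mem_states]
  cases s <;> simp

theorem step_mem_states {s s' : CheckState} {a : ℕ} {b : Bool} {d : SignType}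
    (hs : s ∈ B.states) (h : B.step s a b = some (s', d)) : s' ∈ B.states := by
  rcases step_eq_some h with ⟨rfl, -⟩ | ⟨l, i, j, rfl, rfl, hj, -⟩ | ⟨l, i, rfl, rfl, -⟩ |
    ⟨l, g, rfl, rfl | rfl, -⟩ | ⟨l, i, j, rfl, rfl, hj, -⟩
  · exact mem_states.2 (Or.inl rfl)
  · have h := mem_states_iff.1 hs
    exact mem_states_iff.2 ⟨h.1, hj h.2⟩
  · exact seek_mem_states (mem_states_iff.1 hs).1 le_rfl
  · exact hs
  · have h := mem_states_iff.1 hs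
    exact seek_mem_states h.1 h.2.le
  · have h := mem_states_iff.1 hs
    exact mem_states_iff.2 ⟨h.1, hj h.2⟩

theorem mem_localInstrs {r : Instr} : r ∈ B.localInstrs ↔
    (∃ s ∈ B.states, ∃ a < B.numLetters, ∃ b s' d, B.step s a b = some (s', d) ∧
      r = (s.num, some a, b, s'.num, d)) ∨
    ∃ s ∈ B.states, ∃ b, B.accept s b = true ∧ r = (s.num, none, b, 2, 0) := by
  simp only [localInstrs, List.mem_flatMap, List.mem_append, List.mem_range, List.mem_map,
    Option.mem_toList, Prod.exists, List.mem_filter, and_or_left, exists_or]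
  refine or_congr ?_ ?_
  · constructor
    · rintro ⟨s, hs, a, ha, b, -, s', d, h, rfl⟩
      exact ⟨s, hs, a, ha, b, s', d, h, rfl⟩
    · rintro ⟨s, hs, a, ha, b, s', d, h, rfl⟩
      exact ⟨s, hs, a, ha, b, by cases b <;> simp, s', d, h, rfl⟩
  · constructor
    · rintro ⟨s, hs, b, ⟨-, h⟩, rfl⟩
      exact ⟨s, hs, b, h, rfl⟩
    · rintro ⟨s, hs, b, h, rfl⟩
      exact ⟨s, hs, b, ⟨by cases b <;> simp, h⟩, rfl⟩

theorem mem_startInstrs {r : Instr} : r ∈ B.startInstrs ↔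
    r = (0, some 1, false, B.base, 0) ∨
    ∃ l < B.numLabels, r = (0, some (l + 2), false, (scan l 0).num, 0) := by
  simp [startInstrs, eq_comm]

theorem mem_prefixInstrs {u : List ℕ} {r : Instr} : r ∈ B.prefixInstrs u ↔
    (∃ i < u.length, r = (B.base + i, none, false, 2, 0)) ∨
    (∃ i < u.length, ∃ a < B.numLetters, a ≠ 1 ∧ r = B.compareInstr u i a) ∨
    r = (B.base + u.length, some 0, false, 3, 0) := by
  simp only [prefixInstrs, List.mem_append, List.mem_flatMap, List.mem_range, List.mem_cons,
    List.mem_map, and_or_left, exists_or, or_assoc, numLetters]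
  refine or_congr Iff.rfl (or_congr ?_ (by simp))
  constructor
  · rintro ⟨i, hi, a, rfl | ⟨l, hl, rfl⟩, rfl⟩
    · exact ⟨i, hi, 0, by omega, by omega, rfl⟩
    · exact ⟨i, hi, l + 2, by omega, by omega, rfl⟩
  · rintro ⟨i, hi, a, ha, ha1, rfl⟩
    refine ⟨i, hi, a, ?_, rfl⟩
    match a with
    | 0 => exact Or.inl rfl
    | 1 => simp at ha1
    | l + 2 => exact Or.inr ⟨l, by omega, rfl⟩
end BlockSystem

/-! ### The instructions form a checker -/

namespace BlockSystem

open CheckState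

variable {B : BlockSystem}

theorem mem_instrs {u : List ℕ} {r : Instr} :
    r ∈ B.instrs u ↔ r ∈ B.startInstrs ∨ r ∈ B.localInstrs ∨ r ∈ B.prefixInstrs u := by
  simp [instrs]

theorem source_of_mem_startInstrs {r : Instr} (h : r ∈ B.startInstrs) : r.1 = 0 := by
  rcases mem_startInstrs.1 h with rfl | ⟨l, -, rfl⟩ <;> rfl

theorem source_of_mem_localInstrs {r : Instr} (h : r ∈ B.localInstrs) :
    ∃ s ∈ B.states, r.1 = s.num := by
  rcases mem_localInstrs.1 h with ⟨s, hs, a, -, b, s', d, -, rfl⟩ | ⟨s, hs, b, -, rfl⟩ <;>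
    exact ⟨s, hs, rfl⟩

theorem source_of_mem_prefixInstrs {u : List ℕ} {r : Instr} (h : r ∈ B.prefixInstrs u) :
    ∃ i ≤ u.length, r.1 = B.base + i := by
  rcases mem_prefixInstrs.1 h with ⟨i, hi, rfl⟩ | ⟨i, hi, a, -, -, rfl⟩ | rfl
  · exact ⟨i, hi.le, rfl⟩
  · exact ⟨i, hi.le, rfl⟩
  · exact ⟨_, le_rfl, rfl⟩

/-- The three groups of instructions have disjoint ranges of sources: `0`, the numbers from `3` to
`B.base - 1`, and those from `B.base` on. -/
theorem mem_instrs_zero {u : List ℕ} {r : Option ℕ × Bool × ℕ × SignType} :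
    (0, r) ∈ B.instrs u ↔ (0, r) ∈ B.startInstrs := by
  refine ⟨fun h => ?_, fun h => mem_instrs.2 (Or.inl h)⟩
  rcases mem_instrs.1 h with h | h | h
  · exact h
  · obtain ⟨s, hs, h⟩ := source_of_mem_localInstrs h
    have := s.three_le_num
    simp only at h
    omega
  · obtain ⟨i, hi, h⟩ := source_of_mem_prefixInstrs h
    have := B.three_lt_base
    simp only at h
    omega

theorem mem_instrs_num {u : List ℕ} {s : CheckState} (hs : s ∈ B.states)
    {a : Option ℕ} {b : Bool} {p : ℕ} {d : SignType} :
    (s.num, a, b, p, d) ∈ B.instrs u ↔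
      (∃ a' < B.numLetters, ∃ s', a = some a' ∧ B.step s a' b = some (s', d) ∧ p = s'.num) ∨
      (a = none ∧ B.accept s b = true ∧ p = 2 ∧ d = 0) := by
  trans (s.num, a, b, p, d) ∈ B.localInstrs
  · refine ⟨fun h => ?_, fun h => mem_instrs.2 (Or.inr (Or.inl h))⟩
    rcases mem_instrs.1 h with h | h | h
    · have := source_of_mem_startInstrs h
      have := s.three_le_num
      simp only at *
      omega
    · exact h
    · obtain ⟨i, hi, h⟩ := source_of_mem_prefixInstrs h
      have := num_lt_base hs
      simp only at h
      omega
  · rw [mem_localInstrs]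
    constructor
    · rintro (⟨t, -, a', ha', b', s', d', h, he⟩ | ⟨t, -, b', h, he⟩)
      · simp only [Prod.mk.injEq] at he
        obtain ⟨he, rfl, rfl, rfl, rfl⟩ := he
        cases num_injective he
        exact Or.inl ⟨a', ha', s', rfl, h, rfl⟩
      · simp only [Prod.mk.injEq] at he
        obtain ⟨he, rfl, rfl, rfl, rfl⟩ := he
        cases num_injective he
        exact Or.inr ⟨rfl, h, rfl, rfl⟩
    · rintro (⟨a', ha', s', rfl, h, rfl⟩ | ⟨rfl, h, rfl, rfl⟩)
      · exact Or.inl ⟨s, hs, a', ha', b, s', d, h, rfl⟩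
      · exact Or.inr ⟨s, hs, b, h, rfl⟩

theorem mem_instrs_base {u : List ℕ} {i : ℕ} {a : Option ℕ} {b : Bool} {p : ℕ} {d : SignType} :
    (B.base + i, a, b, p, d) ∈ B.instrs u ↔ b = false ∧ d = 0 ∧
      ((i < u.length ∧ a = none ∧ p = 2) ∨
        (i < u.length ∧ ∃ a' < B.numLetters, a' ≠ 1 ∧ a = some a' ∧
          p = if a' = u.getD i 0 then B.base + i + 1 else 3) ∨
        (i = u.length ∧ a = some 0 ∧ p = 3)) := by
  trans (B.base + i, a, b, p, d) ∈ B.prefixInstrs u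
  · refine ⟨fun h => ?_, fun h => mem_instrs.2 (Or.inr (Or.inr h))⟩
    rcases mem_instrs.1 h with h | h | h
    · have := source_of_mem_startInstrs h
      have := B.three_lt_base
      simp only at *
      omega
    · obtain ⟨s, hs, h⟩ := source_of_mem_localInstrs h
      have := num_lt_base hs
      simp only at h
      omega
    · exact h
  · rw [mem_prefixInstrs]
    constructor
    · rintro (⟨i', hi', he⟩ | ⟨i', hi', a', ha', ha1, he⟩ | he)
      · simp only [Prod.mk.injEq, Nat.add_left_cancel_iff] at he
        obtain ⟨rfl, rfl, rfl, rfl, rfl⟩ := he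
        exact ⟨rfl, rfl, Or.inl ⟨hi', rfl, rfl⟩⟩
      · simp only [compareInstr, Prod.mk.injEq, Nat.add_left_cancel_iff] at he
        obtain ⟨rfl, rfl, rfl, rfl, rfl⟩ := he
        exact ⟨rfl, rfl, Or.inr (Or.inl ⟨hi', a', ha', ha1, rfl, rfl⟩)⟩
      · simp only [Prod.mk.injEq, Nat.add_left_cancel_iff] at he
        obtain ⟨rfl, rfl, rfl, rfl, rfl⟩ := he
        exact ⟨rfl, rfl, Or.inr (Or.inr ⟨rfl, rfl, rfl⟩)⟩
    · rintro ⟨rfl, rfl, ⟨hi, rfl, rfl⟩ | ⟨hi, a', ha', ha1, rfl, rfl⟩ | ⟨rfl, rfl, rfl⟩⟩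
      · exact Or.inl ⟨i, hi, rfl⟩
      · exact Or.inr (Or.inl ⟨i, hi, a', ha', ha1, rfl⟩)
      · exact Or.inr (Or.inr rfl)

theorem source_cases {u : List ℕ} {q : ℕ} {r : Option ℕ × Bool × ℕ × SignType}
    (h : (q, r) ∈ B.instrs u) :
    q = 0 ∨ (∃ s ∈ B.states, q = s.num) ∨ ∃ i ≤ u.length, q = B.base + i := by
  rcases mem_instrs.1 h with h | h | h
  · exact Or.inl (source_of_mem_startInstrs h)
  · exact Or.inr (Or.inl (source_of_mem_localInstrs h))
  · exact Or.inr (Or.inr (source_of_mem_prefixInstrs h))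

theorem scan_mem_states {l : ℕ} (hl : l < B.numLabels) : scan l 0 ∈ B.states :=
  mem_states.2 (Or.inr (Or.inl ⟨l, hl, 0, B.inMod_pos l, rfl⟩))

theorem step_false_nonneg {s s' : CheckState} {a : ℕ} {d : SignType}
    (h : B.step s a false = some (s', d)) : 0 ≤ d := by
  rcases step_eq_some h with ⟨-, rfl⟩ | ⟨l, i, j, -, -, -, rfl | rfl⟩ | ⟨l, i, -, -, rfl⟩ |
    ⟨l, g, -, -, rfl⟩ | ⟨l, i, j, -, -, -, rfl | ⟨-, h⟩⟩
  all_goals first | decide | simp at h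

/-- In states of parity `0` the counter is not decremented, in those of parity `1` it is not
incremented. -/
def _root_.CheckState.parity : CheckState → ℕ
  | ok => 1
  | scan _ _ => 0
  | skip _ _ => 0
  | comp _ _ => 1

theorem parity_le (s : CheckState) : s.parity ≤ 1 := by
  cases s <;> simp [parity]

/-- The phase of a state: the counter is decremented during comparisons only. -/
def phase (B : BlockSystem) (q : ℕ) : ℕ :=
  if q = 2 ∨ (0 < q ∧ q < B.base ∧ q % 3 = 0) then 1 else 0

/-- The numbering makes exactly `ok` and the `comp` states multiples of `3`. -/
theorem phase_num {s : CheckState} (hs : s ∈ B.states) : B.phase s.num = s.parity := by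
  have h1 := num_lt_base hs
  cases s with
  | ok => exact if_pos (Or.inr ⟨by decide, h1, by decide⟩)
  | scan l i => exact if_neg (by simp only [num] at *; omega)
  | skip l g => exact if_neg (by simp only [num] at *; omega)
  | comp l i => exact if_pos (by simp only [num] at *; omega)

theorem phase_base_add (i : ℕ) : B.phase (B.base + i) = 0 := by
  have := B.three_lt_base
  rw [phase, if_neg (by omega)]

theorem phase_le (q : ℕ) : B.phase q ≤ 1 := by
  unfold phase
  split_ifs <;> simp

theorem phase_step {s s' : CheckState} (hs : s ∈ B.states) {a : ℕ} {b : Bool} {d : SignType}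
    (h : B.step s a b = some (s', d)) :
    B.phase s.num ≤ B.phase s'.num ∧ CounterMachine.PhaseAgrees d (B.phase s.num) := by
  rw [phase_num hs, phase_num (step_mem_states hs h)]
  rcases step_eq_some h with ⟨rfl, rfl⟩ | ⟨l, i, j, rfl, rfl, -, rfl | rfl⟩ |
    ⟨l, i, rfl, rfl, rfl⟩ | ⟨l, g, rfl, rfl | rfl, rfl⟩ | ⟨l, i, j, rfl, rfl, -, rfl | ⟨rfl, -⟩⟩
  · exact ⟨parity_le s, by simp [CounterMachine.PhaseAgrees]⟩
  all_goals simp [CounterMachine.PhaseAgrees, parity]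

theorem isChecker_instrs (B : BlockSystem) (u : List ℕ) :
    IsChecker B.numLetters (B.base + u.length + 1) (B.instrs u) := by
  have hbase := B.three_lt_base
  have hok : (3 : ℕ) = ok.num := rfl
  constructor
  · intro q a b p d h
    rcases source_cases h with rfl | ⟨s, hs, rfl⟩ | ⟨i, hi, rfl⟩
    · omega
    · have := s.three_le_num
      have := num_lt_base hs
      omega
    · omega
  · intro q a b p d h
    rcases source_cases h with rfl | ⟨s, hs, rfl⟩ | ⟨i, hi, rfl⟩
    · rcases mem_startInstrs.1 (mem_instrs_zero.1 h) with h | ⟨l, hl, h⟩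
      · simp only [Prod.mk.injEq] at h
        omega
      · simp only [Prod.mk.injEq] at h
        have := (scan l 0).three_le_num
        have := num_lt_base (scan_mem_states hl)
        omega
    · rcases (mem_instrs_num hs).1 h with ⟨a', -, s', -, hstep, rfl⟩ | ⟨-, -, rfl, -⟩
      · have := s'.three_le_num
        have := num_lt_base (step_mem_states hs hstep)
        omega
      · omega
    · obtain ⟨-, -, ⟨h1, -, rfl⟩ | ⟨h1, a', -, -, -, rfl⟩ | ⟨-, -, rfl⟩⟩ := mem_instrs_base.1 h
      · omega
      · split_ifs <;> omega
      · omega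
  · intro q a b p d h
    rcases source_cases h with rfl | ⟨s, hs, rfl⟩ | ⟨i, hi, rfl⟩
    · rcases mem_startInstrs.1 (mem_instrs_zero.1 h) with h | ⟨l, hl, h⟩
      · simp only [Prod.mk.injEq, Option.some.injEq] at h
        unfold numLetters
        omega
      · simp only [Prod.mk.injEq, Option.some.injEq] at h
        have := (scan l 0).three_le_num
        unfold numLetters
        omega
    · rcases (mem_instrs_num hs).1 h with ⟨a', ha', s', he, hstep, rfl⟩ | ⟨h, -⟩
      · obtain rfl := Option.some.inj he
        have := s'.three_le_num
        omega
      · simp at h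
    · obtain ⟨-, -, ⟨h1, h, -⟩ | ⟨h1, a', ha', -, he, rfl⟩ | ⟨-, he, rfl⟩⟩ := mem_instrs_base.1 h
      · simp at h
      · obtain rfl := Option.some.inj he
        split_ifs <;> omega
      · obtain rfl := Option.some.inj he
        unfold numLetters
        omega
  · intro q b p d h
    rcases source_cases h with rfl | ⟨s, hs, rfl⟩ | ⟨i, hi, rfl⟩
    · rcases mem_startInstrs.1 (mem_instrs_zero.1 h) with h | ⟨l, hl, h⟩ <;> simp at h
    · rcases (mem_instrs_num hs).1 h with ⟨a', ha', s', he, -⟩ | ⟨-, -, rfl, rfl⟩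
      · simp at he
      · exact ⟨rfl, rfl⟩
    · obtain ⟨-, rfl, ⟨-, -, rfl⟩ | ⟨-, a', -, -, he, -⟩ | ⟨-, he, -⟩⟩ := mem_instrs_base.1 h
      · exact ⟨rfl, rfl⟩
      · simp at he
      · simp at he
  · intro q a p d h
    rcases source_cases h with rfl | ⟨s, hs, rfl⟩ | ⟨i, hi, rfl⟩
    · rcases mem_startInstrs.1 (mem_instrs_zero.1 h) with h | ⟨l, hl, h⟩ <;>
        simp only [Prod.mk.injEq] at h <;> simp [h]
    · rcases (mem_instrs_num hs).1 h with ⟨a', ha', s', -, hstep, -⟩ | ⟨-, -, -, rfl⟩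
      · exact step_false_nonneg hstep
      · rfl
    · rw [(mem_instrs_base.1 h).2.1]
  · intro a b p d h
    rcases mem_startInstrs.1 (mem_instrs_zero.1 h) with h | ⟨l, hl, h⟩ <;>
      simp only [Prod.mk.injEq] at h <;> simp [h]
  · intro q a b p d p' d' h h'
    rcases source_cases h with rfl | ⟨s, hs, rfl⟩ | ⟨i, hi, rfl⟩
    · rcases mem_startInstrs.1 (mem_instrs_zero.1 h) with h | ⟨l, hl, h⟩ <;>
        rcases mem_startInstrs.1 (mem_instrs_zero.1 h') with h' | ⟨l', hl', h'⟩ <;>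
        simp only [Prod.mk.injEq] at h h' <;>
        obtain ⟨-, rfl, rfl, rfl, rfl⟩ := h <;> simp at h'
      · simp [h']
      · simp [h']
    · rcases (mem_instrs_num hs).1 h with ⟨a', ha', s', rfl, hstep, rfl⟩ | ⟨rfl, -, rfl, rfl⟩
      · rcases (mem_instrs_num hs).1 h' with ⟨a'', -, s'', he, hstep', rfl⟩ | ⟨he, -⟩
        · obtain rfl := Option.some.inj he
          rw [hstep] at hstep'
          simp only [Option.some.injEq, Prod.mk.injEq] at hstep'
          simp [hstep']
        · simp at he
      · rcases (mem_instrs_num hs).1 h' with ⟨a'', -, s'', he, -⟩ | ⟨-, -, rfl, rfl⟩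
        · simp at he
        · exact ⟨rfl, rfl⟩
    · obtain ⟨-, rfl, h1⟩ := mem_instrs_base.1 h
      obtain ⟨-, rfl, h2⟩ := mem_instrs_base.1 h'
      refine ⟨?_, rfl⟩
      rcases h1 with ⟨h1, rfl, rfl⟩ | ⟨h1, a', -, -, rfl, rfl⟩ | ⟨rfl, rfl, rfl⟩ <;>
        rcases h2 with ⟨h2, he, rfl⟩ | ⟨h2, a'', -, -, he, rfl⟩ | ⟨h2, he, rfl⟩
      all_goals first | omega | rfl | (simp at he; done) | skip
      obtain rfl := Option.some.inj he
      rfl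
  · refine ⟨B.phase, phase_le, ?_⟩
    intro q a b p d h
    rcases source_cases h with rfl | ⟨s, hs, rfl⟩ | ⟨i, hi, rfl⟩
    · have h0 : B.phase 0 = 0 := by simp [phase]
      have hd : d = 0 := by
        rcases mem_startInstrs.1 (mem_instrs_zero.1 h) with h | ⟨l, hl, h⟩ <;>
          simp only [Prod.mk.injEq] at h <;> simp [h]
      subst hd
      simp [h0, CounterMachine.PhaseAgrees]
    · rcases (mem_instrs_num hs).1 h with ⟨a', ha', s', -, hstep, rfl⟩ | ⟨-, -, rfl, rfl⟩
      · exact phase_step hs hstep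
      · exact ⟨(phase_le _).trans (by simp [phase]), by simp [CounterMachine.PhaseAgrees]⟩
    · obtain ⟨-, rfl, -⟩ := mem_instrs_base.1 h
      simp [phase_base_add, CounterMachine.PhaseAgrees]
  · simp [numLetters]
  · omega

/-! ### The words accepted by the checker -/

theorem checkerAccepts_num {u : List ℕ} {s : CheckState} (hs : s ∈ B.states) {c : ℕ} {z : List ℕ}
    (hz : ∀ a ∈ z, a < B.numLetters) :
    CheckerAccepts (B.instrs u) s.num c z ↔ B.Detects s c z := by
  induction z generalizing s c with
  | nil => simp [CheckerAccepts, Detects, mem_instrs_num hs]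
  | cons a z ih =>
    simp only [CheckerAccepts, Detects, mem_instrs_num hs]
    have hz' : ∀ a ∈ z, a < B.numLetters := fun b hb => hz b (by simp [hb])
    constructor
    · rintro ⟨q', d, c', ⟨a', -, s', he, hstep, rfl⟩ | ⟨he, -⟩, hc, h⟩
      · obtain rfl := Option.some.inj he
        exact ⟨s', d, c', hstep, hc, (ih (step_mem_states hs hstep) hz').1 h⟩
      · simp at he
    · rintro ⟨s', d, c', hstep, hc, h⟩
      exact ⟨s'.num, d, c', Or.inl ⟨a, hz a (by simp), s', rfl, hstep, rfl⟩, hc,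
        (ih (step_mem_states hs hstep) hz').2 h⟩

theorem checkerAccepts_ok {u : List ℕ} {c : ℕ} {z : List ℕ} (hz : ∀ a ∈ z, a < B.numLetters) :
    CheckerAccepts (B.instrs u) 3 c z ↔ 1 ∉ z := by
  rw [show (3 : ℕ) = ok.num from rfl, checkerAccepts_num (mem_states.2 (Or.inl rfl)) hz, detects_ok]

/-- The part `u₁` has already been matched. A mismatch or a premature end leads to acceptance. After
a complete match only a letter `0` does, because it makes the last block longer than prescribed;
hence the condition on `v.head?`. -/
theorem checkerAccepts_base {z u₁ u₂ : List ℕ} (hz : ∀ a ∈ z, a < B.numLetters) (hu : 1 ∉ u₂) :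
    CheckerAccepts (B.instrs (u₁ ++ u₂)) (B.base + u₁.length) 0 z ↔
      1 ∉ z ∧ ¬ ∃ v, z = u₂ ++ v ∧ v.head? ≠ some 0 := by
  induction u₂ generalizing u₁ z with
  | nil =>
    cases z with
    | nil => simp [CheckerAccepts, mem_instrs_base]
    | cons a z =>
      have hz' : ∀ a ∈ z, a < B.numLetters := fun b hb => hz b (by simp [hb])
      simp only [CheckerAccepts, mem_instrs_base, List.append_nil, lt_irrefl, false_and, false_or]
      constructor
      · rintro ⟨_, _, c', ⟨-, rfl, -, he, rfl⟩, hc, h⟩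
        obtain rfl := Option.some.inj he
        have := (checkerAccepts_ok hz').1 (by simpa using h)
        simp [this]
      · rintro ⟨h1, h2⟩
        have ha : a = 0 := by
          by_contra ha
          exact h2 ⟨a :: z, rfl, by simpa using ha⟩
        subst ha
        exact ⟨3, 0, 0, ⟨by simp, rfl, trivial, rfl, rfl⟩, by simp,
          (checkerAccepts_ok hz').2 fun h => h1 (by simp [h])⟩
  | cons x u₂ ih =>
    have hlen : u₁.length < (u₁ ++ x :: u₂).length := by simp
    cases z with
    | nil => simp [CheckerAccepts, mem_instrs_base]
    | cons a z =>
      have hz' : ∀ a ∈ z, a < B.numLetters := fun b hb => hz b (by simp [hb])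
      have hget : (u₁ ++ x :: u₂).getD u₁.length 0 = x := by simp [List.getD]
      have key : CheckerAccepts (B.instrs (u₁ ++ x :: u₂)) (B.base + u₁.length) 0 (a :: z) ↔
          a ≠ 1 ∧ CheckerAccepts (B.instrs (u₁ ++ x :: u₂))
            (if a = x then B.base + u₁.length + 1 else 3) 0 z := by
        simp only [CheckerAccepts, mem_instrs_base, hget]
        constructor
        · rintro ⟨_, _, c', ⟨-, rfl, ⟨-, he, -⟩ | ⟨-, a', -, h1, he, rfl⟩ | ⟨he, -⟩⟩, hc, h⟩
          · simp at he
          · obtain rfl := Option.some.inj he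
            obtain rfl : c' = 0 := by simpa using hc
            exact ⟨h1, h⟩
          · omega
        · rintro ⟨h1, h⟩
          exact ⟨_, 0, 0, ⟨by simp, rfl, Or.inr (Or.inl ⟨hlen, a, hz a (by simp), h1, rfl, rfl⟩)⟩,
            by simp, h⟩
      rw [key]
      have hu' : 1 ∉ u₂ := fun h => hu (by simp [h])
      by_cases hax : a = x
      · subst hax
        have ha1 : a ≠ 1 := by rintro rfl; simp at hu
        have := ih (u₁ := u₁ ++ [a]) hz' hu'
        rw [List.append_assoc, List.length_append, List.singleton_append, List.length_singleton,
          ← Nat.add_assoc] at this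
        rw [if_pos rfl, this]
        simp [ha1, ha1.symm]
      · rw [if_neg hax, checkerAccepts_ok hz']
        simp only [List.mem_cons, not_or, List.cons_append, List.cons.injEq, hax, false_and,
          exists_false, not_false_eq_true, and_true, ne_comm]

theorem checkerAccepts_start {u z : List ℕ} (hz : ∀ a ∈ z, a < B.numLetters) (hu : 1 ∉ u) :
    CheckerAccepts (B.instrs u) 0 0 z ↔
      (∃ z', z = 1 :: z' ∧ 1 ∉ z' ∧ ¬ ∃ v, z' = u ++ v ∧ v.head? ≠ some 0) ∨
      ∃ l z', z = (l + 2) :: z' ∧ B.Detects (scan l 0) 0 z' := by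
  cases z with
  | nil => simp [CheckerAccepts, mem_instrs_zero, mem_startInstrs]
  | cons a z =>
    have hz' : ∀ a ∈ z, a < B.numLetters := fun b hb => hz b (by simp [hb])
    have ha := hz a (by simp)
    simp only [CheckerAccepts, mem_instrs_zero, mem_startInstrs]
    have hbase := checkerAccepts_base (u₁ := []) hz' hu
    rw [List.nil_append, List.length_nil, Nat.add_zero] at hbase
    constructor
    · rintro ⟨q', d, c', h | ⟨l, hl, h⟩, hc, h'⟩ <;>
        simp only [Prod.mk.injEq, Option.some.injEq] at h <;>
        obtain ⟨-, rfl, -, rfl, rfl⟩ := h <;>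
        obtain rfl : c' = 0 := by simpa using hc
      · exact Or.inl ⟨z, rfl, hbase.1 h'⟩
      · exact Or.inr ⟨l, z, rfl, (checkerAccepts_num (scan_mem_states hl) hz').1 h'⟩
    · rintro (⟨z', he, h⟩ | ⟨l, z', he, h⟩) <;> obtain ⟨rfl, rfl⟩ := List.cons.inj he
      · exact ⟨_, 0, 0, Or.inl rfl, by simp, hbase.2 h⟩
      · have hl : l < B.numLabels := by unfold numLetters at ha; omega
        exact ⟨_, 0, 0, Or.inr ⟨l, hl, rfl⟩, by simp,
          (checkerAccepts_num (scan_mem_states hl) hz').2 h⟩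

/-! ### Density of the checker and existence of histories -/

/-- There is a valid history that begins with the blocks `bs`. -/
def HasHistory (B : BlockSystem) (bs : List (ℕ × ℕ)) : Prop := ∃ bs', B.Valid (bs ++ bs')

theorem Valid.label_lt {bs : List (ℕ × ℕ)} (h : B.Valid bs) : ∀ b ∈ bs, b.1 < B.numLabels := by
  induction bs with
  | nil => simp
  | cons b bs ih =>
    intro b' hb'
    rcases List.mem_cons.1 hb' with rfl | hb'
    · exact h.1
    · exact ih h.2.2 b' hb'

/-- The checker is started at the first block that violates its local condition. -/
theorem exists_detects_of_not_valid {bs : List (ℕ × ℕ)} (hlt : ∀ b ∈ bs, b.1 < B.numLabels)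
    (h : ¬ B.Valid bs) : ∃ l z, (l + 2) :: z <:+ word bs ∧ B.Detects (scan l 0) 0 z := by
  induction bs with
  | nil => exact absurd trivial h
  | cons b bs ih =>
    by_cases hb : B.LocallyValid b bs
    · obtain ⟨l, z, hz, hd⟩ := ih (fun b' hb' => hlt b' (by simp [hb']))
        fun hv => h ⟨hlt b (by simp), hb, hv⟩
      refine ⟨l, z, hz.trans ?_, hd⟩
      exact (List.suffix_append _ _).trans (List.suffix_cons _ _)
    · exact ⟨b.1, _, List.suffix_rfl, detects_read_iff.2 hb⟩

/-- The interior of a block consists of zeros, so a suffix that begins with a label begins at a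
block boundary. -/
theorem not_detects_of_valid {bs : List (ℕ × ℕ)} (h : B.Valid bs) {l : ℕ} {z : List ℕ}
    (hz : (l + 2) :: z <:+ word bs) : ¬ B.Detects (scan l 0) 0 z := by
  induction bs with
  | nil => simp [word] at hz
  | cons b bs ih =>
    rw [word, List.suffix_cons_iff] at hz
    rcases hz with hz | hz
    · obtain ⟨hl, rfl⟩ := List.cons.inj hz
      obtain rfl : l = b.1 := by omega
      rw [detects_read_iff, not_not]
      exact h.2.1
    · refine ih h.2.2 ?_
      generalize b.2 = c at hz
      induction c with
      | zero => simpa using hz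
      | succ c ihc =>
        rw [List.replicate_succ, List.cons_append, List.suffix_cons_iff] at hz
        rcases hz with hz | hz
        · simp at hz
        · exact ihc hz

theorem isCheckerDense_instrs (bs : List (ℕ × ℕ)) (hne : bs ≠ []) :
    IsCheckerDense B.numLetters (B.instrs (word bs)) ↔ ¬ B.HasHistory bs := by
  have hu := one_notMem_word bs
  constructor
  · rintro h ⟨bs', hv⟩
    -- The word `1` followed by a history refutes density.
    have hw : ∀ a ∈ 1 :: word (bs ++ bs'), a < B.numLetters := by
      intro a ha
      rcases List.mem_cons.1 ha with rfl | ha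
      · simp [numLetters]
      · exact lt_of_mem_word.2 hv.label_lt a ha
    obtain ⟨z, hz, hzw⟩ := h _ hw
    rcases (checkerAccepts_start (CheckerAccepts.lt (B.isChecker_instrs _) hz) hu).1 hz with
      ⟨z', rfl, h1, h2⟩ | ⟨l, z', rfl, hd⟩
    -- Both words contain `1` only as their first letter, so comparability forces equality.
    · have hz' : z' = word (bs ++ bs') := by
        rcases hzw with hzw | hzw <;> rw [List.suffix_cons_iff] at hzw <;> rcases hzw with hzw | hzw
        · exact (List.cons.inj hzw).2
        · exact absurd (hzw.subset (by simp)) (one_notMem_word _)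
        · exact (List.cons.inj hzw).2.symm
        · exact absurd (hzw.subset (by simp)) h1
      exact h2 ⟨word bs', by rw [hz', word_append], head?_word _⟩
    · rcases hzw with hzw | hzw <;> rw [List.suffix_cons_iff] at hzw <;> rcases hzw with hzw | hzw
      · simp at hzw
      · exact not_detects_of_valid hv hzw hd
      · simp at hzw
      · exact hd.one_notMem (hzw.subset (by simp))
  · intro h w hw
    suffices hs : ∃ z, (∀ a ∈ z, a < B.numLetters) ∧ (z <:+ w ∨ w <:+ z) ∧
        ((∃ z', z = 1 :: z' ∧ 1 ∉ z' ∧ ¬ ∃ v, z' = word bs ++ v ∧ v.head? ≠ some 0) ∨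
          ∃ l z', z = (l + 2) :: z' ∧ B.Detects (scan l 0) 0 z') by
      obtain ⟨z, hlt, hzw, hz⟩ := hs
      exact ⟨z, (checkerAccepts_start hlt hu).2 hz, hzw⟩
    by_cases h1 : 1 ∈ w
    -- Only the part after the last `1` matters.
    · obtain ⟨y, v, rfl, hv⟩ : ∃ y v, w = y ++ 1 :: v ∧ 1 ∉ v := by
        clear hw
        induction w with
        | nil => simp at h1
        | cons a w ih =>
          by_cases hw : 1 ∈ w
          · obtain ⟨y, v, rfl, hv⟩ := ih hw
            exact ⟨a :: y, v, rfl, hv⟩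
          · obtain rfl : 1 = a := by simpa [hw] using h1
            exact ⟨[], w, rfl, hw⟩
      by_cases hp : ∃ v', v = word bs ++ v' ∧ v'.head? ≠ some 0
      · obtain ⟨v', rfl, hv'⟩ := hp
        obtain ⟨bs', rfl⟩ := exists_eq_word (fun h => hv (by simp [h])) hv'
        rw [← word_append] at hw ⊢
        have hlt : ∀ a ∈ word (bs ++ bs'), a < B.numLetters := fun a ha => hw a (by simp [ha])
        obtain ⟨l, z, hz, hd⟩ := exists_detects_of_not_valid (lt_of_mem_word.1 hlt)
          fun hv => h ⟨bs', hv⟩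
        refine ⟨(l + 2) :: z, fun a ha => hlt a (hz.subset ha), Or.inl ?_, Or.inr ⟨l, z, rfl, hd⟩⟩
        exact hz.trans ((List.suffix_cons _ _).trans (List.suffix_append _ _))
      · exact ⟨1 :: v, fun a ha => hw a (List.mem_append_right _ ha),
          Or.inl (List.suffix_append _ _), Or.inl ⟨v, rfl, hv, hp⟩⟩
    -- The prescribed beginning starts with a label, so the inserted `0` is a wrong beginning.
    · refine ⟨1 :: 0 :: w, ?_, Or.inr ((List.suffix_cons _ _).trans (List.suffix_cons _ _)),
        Or.inl ⟨0 :: w, rfl, by simpa using h1, ?_⟩⟩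
      · intro a ha
        simp only [List.mem_cons] at ha
        rcases ha with rfl | rfl | ha
        · simp [numLetters]
        · simp [numLetters]
        · exact hw a ha
      · rintro ⟨v, he, hv⟩
        cases bs with
        | nil => exact hne rfl
        | cons b bs => simp [word] at he

end BlockSystem

/-! ### Rule systems with four registers -/

open Turing Turing.PartrecToTM2

/-- The relation between `x` and `y` that `x = inMod * t + inRem` and `y = outMod * t + outRem`
for some `t`, the remainders being smaller than the moduli. -/
structure AffineOp where
  inMod : ℕ
  inRem : ℕ
  outMod : ℕ
  outRem : ℕ
  inMod_pos : 0 < inMod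
  outMod_pos : 0 < outMod

/-- The relation described by an operation. -/
def AffineOp.Rel (a : AffineOp) (x y : ℕ) : Prop :=
  x % a.inMod = a.inRem ∧ y % a.outMod = a.outRem ∧ y / a.outMod = x / a.inMod

/-- A finite system of rules, each of which acts on four registers. -/
structure RuleSystem (R : Type) where
  op : R → K' → AffineOp
  next : R → R → Prop
  final : R → Prop

namespace RuleSystem

variable {R : Type} (A : RuleSystem R)

/-- A sequence of rules leads from the given rule and register contents to a final rule. -/
inductive Halts : R → (K' → ℕ) → Prop
  | final {r : R} {c : K' → ℕ} : A.final r → (∀ k, c k % (A.op r k).inMod = (A.op r k).inRem) →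
      Halts r c
  | step {r r' : R} {c c' : K' → ℕ} : A.next r r' → (∀ k, (A.op r k).Rel (c k) (c' k)) →
      Halts r' c' → Halts r c

instance : Fintype K' :=
  ⟨{K'.main, K'.rev, K'.aux, K'.stack}, fun k => by cases k <;> simp⟩

/-- The labels of consecutive blocks. -/
def NextLabel : R × K' → R × K' → Prop
  | (r, .main), (r', .rev) => r = r'
  | (r, .rev), (r', .aux) => r = r'
  | (r, .aux), (r', .stack) => r = r'
  | (r, .stack), (r', .main) => A.next r r'
  | _, _ => False

/-- The position of a register in a row of blocks. -/
def position : K' → ℕ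
  | .main => 0
  | .rev => 1
  | .aux => 2
  | .stack => 3

theorem forall_registers {P : K' → Prop} :
    (∀ k, P k) ↔ P K'.main ∧ P K'.rev ∧ P K'.aux ∧ P K'.stack :=
  ⟨fun h => ⟨h _, h _, h _, h _⟩, fun ⟨h1, h2, h3, h4⟩ k => by cases k <;> assumption⟩

section

variable {A} {r : R} {x : R × K'}

theorem nextLabel_main : A.NextLabel (r, K'.main) x ↔ x = (r, K'.rev) := by
  obtain ⟨r', k⟩ := x
  cases k <;> simp [NextLabel, eq_comm]

theorem nextLabel_rev : A.NextLabel (r, K'.rev) x ↔ x = (r, K'.aux) := by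
  obtain ⟨r', k⟩ := x
  cases k <;> simp [NextLabel, eq_comm]

theorem nextLabel_aux : A.NextLabel (r, K'.aux) x ↔ x = (r, K'.stack) := by
  obtain ⟨r', k⟩ := x
  cases k <;> simp [NextLabel, eq_comm]

theorem nextLabel_stack :
    A.NextLabel (r, K'.stack) x ↔ ∃ r', x = (r', K'.main) ∧ A.next r r' := by
  obtain ⟨r', k⟩ := x
  cases k <;> simp [NextLabel]

end

/-! ### Runs of a rule system as histories -/

section

variable [Fintype R]

/-- The number of a label. -/
noncomputable def label (x : R × K') : ℕ := Fintype.equivFin (R × K') x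

/-- A function of labels as a function of their numbers. -/
noncomputable def extend (f : R × K' → ℕ) (l : ℕ) : ℕ :=
  if h : l < Fintype.card (R × K') then f ((Fintype.equivFin (R × K')).symm ⟨l, h⟩) else 1

theorem label_injective : Function.Injective (label : R × K' → ℕ) :=
  Fin.val_injective.comp (Fintype.equivFin (R × K')).injective

theorem label_lt (x : R × K') : label x < Fintype.card (R × K') := Fin.is_lt _

theorem extend_label (f : R × K' → ℕ) (x : R × K') : extend f (label x) = f x := by
  have h := label_lt x
  unfold extend
  rw [dif_pos h]
  simp [label]

/-- The default value `1` outside the labels keeps the moduli positive. -/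
theorem extend_pos {f : R × K' → ℕ} (hf : ∀ x, 0 < f x) (l : ℕ) : 0 < extend f l := by
  unfold extend
  split_ifs
  · exact hf _
  · exact one_pos

open Classical in
/-- The block system whose histories are the runs of a rule system. A rule with the contents of
the registers is represented by four blocks. -/
noncomputable def blockSystem : BlockSystem where
  numLabels := Fintype.card (R × K')
  skipped := 3
  inMod := extend fun x => (A.op x.1 x.2).inMod
  inRem := extend fun x => (A.op x.1 x.2).inRem
  outMod := extend fun x => (A.op x.1 x.2).outMod
  outRem := extend fun x => (A.op x.1 x.2).outRem
  next l l' := decide (∃ x x', l = label x ∧ l' = label x' ∧ A.NextLabel x x')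
  final l := decide (∃ r, l = label (r, K'.stack) ∧ A.final r)
  inMod_pos := extend_pos fun _ => AffineOp.inMod_pos _
  outMod_pos := extend_pos fun _ => AffineOp.outMod_pos _

/-- The block of a rule for one register. -/
noncomputable def block (r : R) (c : K' → ℕ) (k : K') : ℕ × ℕ := (label (r, k), c k)

/-- The blocks of a rule with register contents. -/
noncomputable def row (r : R) (c : K' → ℕ) : List (ℕ × ℕ) :=
  [block r c K'.main, block r c K'.rev, block r c K'.aux, block r c K'.stack]

variable {A}

theorem next_label {x : R × K'} {l : ℕ} :
    A.blockSystem.next (label x) l = true ↔ ∃ x', l = label x' ∧ A.NextLabel x x' := by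
  simp only [blockSystem, decide_eq_true_eq]
  constructor
  · rintro ⟨y, x', he, h⟩
    cases label_injective he
    exact ⟨x', h⟩
  · rintro ⟨x', h⟩
    exact ⟨x, x', rfl, h⟩

theorem final_label {r : R} {k : K'} :
    A.blockSystem.final (label (r, k)) = true ↔ k = K'.stack ∧ A.final r := by
  simp only [blockSystem, decide_eq_true_eq]
  constructor
  · rintro ⟨r', he, h⟩
    cases label_injective he
    exact ⟨rfl, h⟩
  · rintro ⟨rfl, h⟩
    exact ⟨r, rfl, h⟩

theorem locallyValid_block {r : R} {c : K' → ℕ} {k : K'} {rest : List (ℕ × ℕ)} :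
    A.blockSystem.LocallyValid (block r c k) rest ↔
      c k % (A.op r k).inMod = (A.op r k).inRem ∧
      (∀ b ∈ rest.head?, ∃ x', b.1 = label x' ∧ A.NextLabel (r, k) x') ∧
      (rest = [] → k = K'.stack ∧ A.final r) ∧
      ∀ b ∈ rest[3]?, b.2 % (A.op r k).outMod = (A.op r k).outRem ∧
        b.2 / (A.op r k).outMod = c k / (A.op r k).inMod := by
  unfold BlockSystem.LocallyValid block
  simp only [next_label, final_label]
  simp only [blockSystem, extend_label]

theorem valid_block_cons {r : R} {c : K' → ℕ} {k : K'} {rest : List (ℕ × ℕ)} :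
    A.blockSystem.Valid (block r c k :: rest) ↔
      A.blockSystem.LocallyValid (block r c k) rest ∧ A.blockSystem.Valid rest := by
  exact and_iff_right (label_lt _)

/-- Four blocks later stands the block of the same register in the next row, which is why `skipped`
is `3` and why register `k` is compared with place `position k` of `rest`. -/
theorem valid_row_append {r : R} {c : K' → ℕ} {rest : List (ℕ × ℕ)} :
    A.blockSystem.Valid (row r c ++ rest) ↔
      (∀ k, c k % (A.op r k).inMod = (A.op r k).inRem) ∧
      (∀ b ∈ rest.head?, ∃ r', b.1 = label (r', K'.main) ∧ A.next r r') ∧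
      (rest = [] → A.final r) ∧
      (∀ k, ∀ b ∈ rest[position k]?, b.2 % (A.op r k).outMod = (A.op r k).outRem ∧
        b.2 / (A.op r k).outMod = c k / (A.op r k).inMod) ∧
      A.blockSystem.Valid rest := by
  simp only [row, List.cons_append, List.nil_append, valid_block_cons, locallyValid_block,
    List.head?_cons, Option.mem_def, Option.some.injEq, forall_eq', List.getElem?_cons_succ,
    nextLabel_main, nextLabel_rev, nextLabel_aux, nextLabel_stack, forall_registers, position]
  simp [block]
  tauto

/-- The relation between consecutive labels fixes the order of the registers, and only a block of
the last register may end a history, so a row that has begun is complete. -/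
theorem exists_eq_row_append {r : R} {rest : List (ℕ × ℕ)} (hne : rest ≠ [])
    (hrest : ∀ b ∈ rest.head?, b.1 = label (r, K'.main)) (h : A.blockSystem.Valid rest) :
    ∃ c rest', rest = row r c ++ rest' := by
  have key : ∀ {k k' : K'} {b : ℕ × ℕ} {rest : List (ℕ × ℕ)}, k ≠ K'.stack →
      (∀ x, A.NextLabel (r, k) x → x = (r, k')) → b.1 = label (r, k) →
      A.blockSystem.Valid (b :: rest) →
      ∃ b' rest', rest = b' :: rest' ∧ b'.1 = label (r, k') ∧ A.blockSystem.Valid rest := by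
    rintro k k' ⟨l, n⟩ rest hk hnext (rfl : l = _) h
    obtain ⟨h, h'⟩ := valid_block_cons (c := fun _ => n).1 h
    obtain ⟨-, h1, h2, -⟩ := locallyValid_block.1 h
    cases rest with
    | nil => exact absurd (h2 rfl).1 hk
    | cons b' rest =>
      obtain ⟨x, hb', hx⟩ := h1 b' rfl
      exact ⟨b', rest, rfl, by rw [hb', hnext x hx], h'⟩
  obtain ⟨b₁, rest₁, rfl⟩ := List.exists_cons_of_ne_nil hne
  obtain ⟨b₂, rest₂, rfl, h₂, hv₂⟩ := key (k' := K'.rev) (by simp) (fun _ => nextLabel_main.1)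
    (hrest b₁ rfl) h
  obtain ⟨b₃, rest₃, rfl, h₃, hv₃⟩ := key (k' := K'.aux) (by simp) (fun _ => nextLabel_rev.1) h₂ hv₂
  obtain ⟨b₄, rest₄, rfl, h₄, hv₄⟩ := key (k' := K'.stack) (by simp) (fun _ => nextLabel_aux.1)
    h₃ hv₃
  refine ⟨fun k => match k with
    | .main => b₁.2
    | .rev => b₂.2
    | .aux => b₃.2
    | .stack => b₄.2, rest₄, ?_⟩
  simp only [row, block, ← hrest b₁ rfl, ← h₂, ← h₃, ← h₄, List.cons_append, List.nil_append]

theorem getElem?_row_append {r : R} {c : K' → ℕ} {rest : List (ℕ × ℕ)} (k : K') :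
    (row r c ++ rest)[position k]? = some (block r c k) := by
  cases k <;> rfl

theorem hasHistory_row {r : R} {c : K' → ℕ} : A.blockSystem.HasHistory (row r c) ↔ A.Halts r c := by
  constructor
  · rintro ⟨rest, h⟩
    generalize hn : rest.length = n
    induction n using Nat.strong_induction_on generalizing r c rest with
    | _ n ih =>
      obtain ⟨h1, h2, h3, h4, h5⟩ := valid_row_append.1 h
      by_cases hne : rest = []
      · exact .final (h3 hne) h1
      · obtain ⟨r', hr', hnext⟩ := h2 (rest.head hne) (List.head?_eq_some_head hne)
        obtain ⟨c', rest', rfl⟩ := exists_eq_row_append (r := r') hne (fun b hb => by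
          rw [List.head?_eq_some_head hne] at hb
          rw [← Option.some.inj hb, hr']) h5
        refine .step hnext (fun k => ⟨h1 k, ?_⟩) (ih _ ?_ _ h5 rfl)
        · exact h4 k _ (getElem?_row_append k)
        · rw [← hn, List.length_append]
          exact Nat.lt_add_of_pos_left (Nat.succ_pos 3)
  · intro h
    induction h with
    | final hr hc => exact ⟨[], valid_row_append.2 ⟨hc, by simp, fun _ => hr, by simp, trivial⟩⟩
    | @step r r' c c' hnext hrel _ ih =>
      obtain ⟨rest, ih⟩ := ih
      refine ⟨row r' c' ++ rest, valid_row_append.2 ⟨fun k => (hrel k).1, ?_, ?_, ?_, ih⟩⟩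
      · intro b hb
        obtain rfl : block r' c' K'.main = b := Option.some.inj hb
        exact ⟨r', rfl, hnext⟩
      · intro h
        simp [row] at h
      · intro k b hb
        rw [getElem?_row_append] at hb
        obtain rfl := Option.some.inj hb
        exact (hrel k).2

end

end RuleSystem

/-! ### Stacks as numbers -/

namespace StackNumber

/-- The digit of a stack symbol. -/
def digit : Γ' → ℕ
  | .consₗ => 1
  | .cons => 2
  | .bit0 => 3
  | .bit1 => 4

/-- The symbol with a given digit. -/
def symbol : ℕ → Option Γ'
  | 1 => some .consₗ
  | 2 => some .cons
  | 3 => some .bit0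
  | 4 => some .bit1
  | _ => none

/-- A stack as a number in base five. -/
def value : List Γ' → ℕ
  | [] => 0
  | a :: s => 5 * value s + digit a

theorem digit_lt (a : Γ') : digit a < 5 := by cases a <;> simp [digit]

theorem value_cons_mod (a : Γ') (s : List Γ') : value (a :: s) % 5 = digit a := by
  have := digit_lt a
  rw [value]
  omega

theorem value_cons_div (a : Γ') (s : List Γ') : value (a :: s) / 5 = value s := by
  have := digit_lt a
  rw [value]
  omega

/-- No symbol has digit `0`, so residue `0` identifies the empty stack. -/
theorem symbol_value_mod (s : List Γ') : symbol (value s % 5) = s.head? := by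
  cases s with
  | nil => rfl
  | cons a s =>
    rw [value_cons_mod]
    cases a <;> rfl

theorem value_div (s : List Γ') : value s / 5 = value s.tail := by
  cases s with
  | nil => rfl
  | cons a s => exact value_cons_div a s

end StackNumber

/-! ### Stack programs as rule systems -/

namespace StackProgram

open StackNumber TM2.Stmt

/-- The statements of the programs. -/
abbrev Statement : Type := TM2.Stmt (fun _ : K' => Γ') Λ' (Option Γ')

/-- The operation that leaves a register unchanged. -/
def keepOp : AffineOp := ⟨1, 0, 1, 0, one_pos, one_pos⟩

/-- The operation of a statement on a register, `g` being the lowest digit of the register that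
it reads. -/
def op : Option Statement → Option Γ' → ℕ → K' → AffineOp
  | some (push k f _), v, _, k' =>
    if k' = k then ⟨1, 0, 5, digit (f v), one_pos, Nat.succ_pos 4⟩ else keepOp
  | some (peek k _ _), _, g, k' =>
    if k' = k then ⟨5, g, 5, g, Nat.succ_pos 4, Nat.succ_pos 4⟩ else keepOp
  | some (pop k _ _), _, g, k' =>
    if k' = k then ⟨5, g, 1, 0, Nat.succ_pos 4, one_pos⟩ else keepOp
  | _, _, _, _ => keepOp

/-- The statement and the internal state after a statement. -/
def target : Option Statement → Option Γ' → ℕ → Option (Option Statement × Option Γ')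
  | some (push _ _ q), v, _ => some (some q, v)
  | some (peek _ f q), v, g => some (some q, f v (symbol g))
  | some (pop _ f q), v, g => some (some q, f v (symbol g))
  | some (load f q), v, _ => some (some q, f v)
  | some (branch f q₁ q₂), v, _ => some (some (if f v then q₁ else q₂), v)
  | some (goto f), v, _ => some (some (tr (f v)), v)
  | some TM2.Stmt.halt, v, _ => some (none, v)
  | none, _, _ => none

/-- The configurations of a program that executes single statements on registers. -/
abbrev Config : Type := Option Statement × Option Γ' × (K' → ℕ)

/-- The execution of a single statement. -/
def step : Config → Option Config
  | (some (push k f q), v, c) => some (some q, v, Function.update c k (5 * c k + digit (f v)))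
  | (some (peek k f q), v, c) => some (some q, f v (symbol (c k % 5)), c)
  | (some (pop k f q), v, c) =>
    some (some q, f v (symbol (c k % 5)), Function.update c k (c k / 5))
  | (some (load f q), v, c) => some (some q, f v, c)
  | (some (branch f q₁ q₂), v, c) => some (some (if f v then q₁ else q₂), v, c)
  | (some (goto f), v, c) => some (some (tr (f v)), v, c)
  | (some TM2.Stmt.halt, v, c) => some (none, v, c)
  | (none, _, _) => none

theorem keepOp_rel {x y : ℕ} : keepOp.Rel x y ↔ y = x := by
  simp [keepOp, AffineOp.Rel, Nat.mod_one]

theorem forall_keepOp_rel {c c' : K' → ℕ} : (∀ k, keepOp.Rel (c k) (c' k)) ↔ c' = c := by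
  simp [keepOp_rel, funext_iff]

theorem forall_ite_rel {a : AffineOp} {k : K'} {c c' : K' → ℕ} :
    (∀ k', (if k' = k then a else keepOp).Rel (c k') (c' k')) ↔
      a.Rel (c k) (c' k) ∧ c' = Function.update c k (c' k) := by
  constructor
  · intro h
    refine ⟨by simpa using h k, funext fun k' => ?_⟩
    by_cases hk : k' = k
    · subst hk; simp
    · have := h k'
      rw [if_neg hk, keepOp_rel] at this
      simp [hk, this]
  · rintro ⟨h1, h2⟩ k'
    by_cases hk : k' = k
    · subst hk; simpa using h1
    · rw [if_neg hk, keepOp_rel, h2]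
      simp [hk]

/-- The digit `g` is a guess that the operation verifies: for `peek` and `pop` only the true lowest
digit of the register is compatible with it. The other statements ignore `g`, and `0` serves as a
witness. -/
theorem step_eq_some_iff {o o' : Option Statement} {v v' : Option Γ'} {c c' : K' → ℕ} :
    step (o, v, c) = some (o', v', c') ↔
      ∃ g < 5, target o v g = some (o', v') ∧ ∀ k, (op o v g k).Rel (c k) (c' k) := by
  have hkeep : ∀ {x : Option Statement × Option Γ'},
      some (x.1, x.2, c) = some (o', v', c') ↔
      ∃ g < 5, some x = some (o', v') ∧ ∀ k, keepOp.Rel (c k) (c' k) := by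
    intro x
    simp only [forall_keepOp_rel, Option.some.injEq, Prod.ext_iff]
    constructor
    · rintro ⟨h1, h2, h3⟩
      exact ⟨0, by omega, ⟨h1, h2⟩, h3.symm⟩
    · rintro ⟨-, -, ⟨h1, h2⟩, h3⟩
      exact ⟨h1, h2, h3.symm⟩
  match o with
  | some (push k f q) =>
    simp only [step, target, op, forall_ite_rel, Option.some.injEq, Prod.mk.injEq]
    simp only [AffineOp.Rel]
    have hd := digit_lt (f v)
    constructor
    · rintro ⟨rfl, rfl, rfl⟩
      refine ⟨0, by omega, ⟨rfl, rfl⟩, ⟨Nat.mod_one _, ?_, ?_⟩, by simp⟩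
      · simp; omega
      · simp; omega
    · rintro ⟨-, -, ⟨rfl, rfl⟩, ⟨-, h1, h2⟩, h3⟩
      refine ⟨rfl, rfl, ?_⟩
      rw [h3]
      congr 1
      simp only [Nat.div_one] at h2
      omega
  | some (peek k f q) =>
    simp only [step, target, op, forall_ite_rel, Option.some.injEq, Prod.mk.injEq]
    simp only [AffineOp.Rel]
    constructor
    · rintro ⟨rfl, rfl, rfl⟩
      exact ⟨c k % 5, Nat.mod_lt _ (by omega), ⟨rfl, rfl⟩, ⟨rfl, rfl, rfl⟩, by simp⟩
    · rintro ⟨g, -, ⟨rfl, rfl⟩, ⟨h1, h2, h3⟩, h4⟩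
      have : c' k = c k := by omega
      rw [h4, this]
      simp [h1]
  | some (pop k f q) =>
    simp only [step, target, op, forall_ite_rel, Option.some.injEq, Prod.mk.injEq]
    simp only [AffineOp.Rel]
    constructor
    · rintro ⟨rfl, rfl, rfl⟩
      exact ⟨c k % 5, Nat.mod_lt _ (by omega), ⟨rfl, rfl⟩,
        ⟨rfl, Nat.mod_one _, by simp⟩, by simp⟩
    · rintro ⟨g, -, ⟨rfl, rfl⟩, ⟨h1, -, h3⟩, h4⟩
      rw [Nat.div_one] at h3
      rw [h4, h3]
      simp [h1]
  | some (load f q) => exact hkeep (x := (some q, f v))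
  | some (branch f q₁ q₂) => exact hkeep (x := (some (if f v then q₁ else q₂), v))
  | some (goto f) => exact hkeep (x := (some (tr (f v)), v))
  | some TM2.Stmt.halt => exact hkeep (x := (none, v))
  | none => simp [step, target]

theorem step_eq_none_iff {x : Config} : step x = none ↔ x.1 = none := by
  obtain ⟨o, v, c⟩ := x
  rcases o with - | q
  · simp [step]
  · cases q <;> simp [step]

/-! ### Simulation of the stack program on registers -/

/-- A configuration of the stack program as a configuration on registers. -/
def ofCfg (C : TM2.Cfg (fun _ : K' => Γ') Λ' (Option Γ')) : Config :=
  (C.l.map tr, C.var, fun k => value (C.stk k))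

theorem value_update (S : K' → List Γ') (k : K') (s : List Γ') :
    (fun k' => value (Function.update S k s k')) =
      Function.update (fun k' => value (S k')) k (value s) :=
  Function.comp_update value S k s

/-- One step of the stack program runs through a statement up to a jump or a halt; on registers
every node on this path is a step of its own. -/
theorem reaches₁_stepAux (q : Statement) (v : Option Γ') (S : K' → List Γ') :
    StateTransition.Reaches₁ step (some q, v, fun k => value (S k))
      (ofCfg (TM2.stepAux q v S)) := by
  induction q generalizing v S with
  | push k f q ih =>
    refine .head (b := _) rfl ?_
    rw [TM2.stepAux]
    have := ih v (Function.update S k (f v :: S k))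
    rw [value_update] at this
    exact this
  | peek k f q ih =>
    refine .head (b := _) rfl ?_
    rw [symbol_value_mod]
    exact ih _ S
  | pop k f q ih =>
    refine .head (b := _) rfl ?_
    rw [symbol_value_mod, value_div, ← value_update]
    exact ih _ _
  | load f q ih =>
    refine .head (b := _) rfl ?_
    exact ih _ S
  | branch f q₁ q₂ ih₁ ih₂ =>
    refine .head (b := _) rfl ?_
    rw [TM2.stepAux]
    cases f v
    · exact ih₂ v S
    · exact ih₁ v S
  | goto f => exact .single rfl
  | halt => exact .single rfl

theorem respects_step :
    StateTransition.Respects (TM2.step tr) step fun C x => ofCfg C = x := by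
  rintro ⟨l, v, S⟩ _ rfl
  cases l with
  | none => rfl
  | some l => exact ⟨_, rfl, reaches₁_stepAux (tr l) v S⟩

theorem eval_dom_iff (C : TM2.Cfg (fun _ : K' => Γ') Λ' (Option Γ')) :
    (StateTransition.eval step (ofCfg C)).Dom ↔ (StateTransition.eval (TM2.step tr) C).Dom :=
  StateTransition.tr_eval_dom respects_step rfl

/-! ### The rule system of a program -/

/-- A rule: a statement from a finite set, the internal state, and the claimed lowest digit of the
register that the statement reads. -/
abbrev Rule (T : Finset (Option Statement)) : Type := T × Option Γ' × Fin 5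

/-- The rule system of the statements in a finite set. -/
def ruleSystem (T : Finset (Option Statement)) : RuleSystem (Rule T) where
  op r := op r.1 r.2.1 r.2.2
  next r r' := target r.1 r.2.1 r.2.2 = some (r'.1.1, r'.2.1)
  final r := r.1.1 = none

/-- A set of statements contains the statements that may follow its elements. -/
def IsClosed (T : Finset (Option Statement)) : Prop :=
  ∀ o ∈ T, ∀ v g o' v', target o v g = some (o', v') → o' ∈ T

theorem eval_dom_of_halts {T : Finset (Option Statement)} {r : Rule T} {c : K' → ℕ}
    (h : (ruleSystem T).Halts r c) :
    (StateTransition.eval step (r.1.1, r.2.1, c)).Dom := by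
  induction h with
  | @final r c hr =>
    rw [Part.dom_iff_mem]
    exact ⟨_, StateTransition.mem_eval.2 ⟨.refl, step_eq_none_iff.2 hr⟩⟩
  | @step r r' c c' hnext hrel _ ih =>
    have hs : step (r.1.1, r.2.1, c) = some (r'.1.1, r'.2.1, c') :=
      step_eq_some_iff.2 ⟨r.2.2, r.2.2.2, hnext, hrel⟩
    rw [StateTransition.reaches_eval (.single hs)]
    exact ih

/-- Going backwards along the run, each statement is completed to a rule by the digit that it
actually reads. -/
theorem exists_halts_of_reaches {T : Finset (Option Statement)} (hT : IsClosed T) {x y : Config}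
    (h : StateTransition.Reaches step x y) (hy : step y = none) :
    ∀ hx : x.1 ∈ T, ∃ g, (ruleSystem T).Halts (⟨x.1, hx⟩, x.2.1, g) x.2.2 := by
  induction h using Relation.ReflTransGen.head_induction_on with
  | refl =>
    intro hx
    refine ⟨0, .final (step_eq_none_iff.1 hy) fun k => ?_⟩
    obtain ⟨o, v, c⟩ := y
    obtain rfl : o = none := step_eq_none_iff.1 hy
    exact Nat.mod_one _
  | @head x x' hs _ ih =>
    intro hx
    obtain ⟨o, v, c⟩ := x
    obtain ⟨o', v', c'⟩ := x'
    obtain ⟨g, hg, htarget, hrel⟩ := step_eq_some_iff.1 hs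
    have hx' := hT o hx v g o' v' htarget
    obtain ⟨g', h⟩ := ih hx'
    exact ⟨⟨g, hg⟩, RuleSystem.Halts.step (A := ruleSystem T) (r' := (⟨o', hx'⟩, v', g')) htarget
      hrel h⟩

/-- The first statement of the program may read a digit, which would make the initial rule depend on
the input. A jump reads nothing, so with it in front the initial rule is always the same, with digit
`0`. -/
theorem halts_goto_iff {T : Finset (Option Statement)} (hT : IsClosed T) {l : Λ'}
    (hl : some (goto fun _ => l) ∈ T) (v : Option Γ') (S : K' → List Γ') :
    (ruleSystem T).Halts (⟨_, hl⟩, v, 0) (fun k => value (S k)) ↔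
      (StateTransition.eval (TM2.step tr) ⟨some l, v, S⟩).Dom := by
  rw [← eval_dom_iff]
  have hs : step (some (goto fun _ => l), v, fun k => value (S k)) =
    some (ofCfg ⟨some l, v, S⟩) := rfl
  constructor
  · intro h
    have := eval_dom_of_halts h
    rwa [StateTransition.reaches_eval (.single hs)] at this
  · intro h
    obtain ⟨y, hy⟩ := Part.dom_iff_mem.1 h
    obtain ⟨hxy, hy⟩ := StateTransition.mem_eval.1 hy
    have hmem : some (tr l) ∈ T := hT _ hl v 0 _ v rfl
    obtain ⟨g, h⟩ := exists_halts_of_reaches hT hxy hy hmem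
    exact RuleSystem.Halts.step (A := ruleSystem T) (r' := (⟨some (tr l), hmem⟩, v, g)) rfl (forall_keepOp_rel.2 rfl) h

open Classical in
/-- The statements of the program with the given code, and a jump to its first statement. -/
noncomputable def statements (c : ToPartrec.Code) : Finset (Option Statement) :=
  insert (some (goto fun _ => trNormal c .halt)) (TM2.stmts tr (codeSupp c .halt))

theorem jump_mem_statements (c : ToPartrec.Code) :
    some (goto fun _ => trNormal c .halt) ∈ statements c :=
  by classical exact Finset.mem_insert_self _ _

theorem some_tr_mem_stmts {L : Finset Λ'} {l : Λ'} (hl : l ∈ L) : some (tr l) ∈ TM2.stmts tr L := by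
  classical
  exact Finset.some_mem_insertNone.2 (Finset.mem_biUnion.2 ⟨l, hl, TM2.stmts₁_self⟩)

theorem isClosed_statements (c : ToPartrec.Code) : IsClosed (statements c) := by
  classical
  let _ : Inhabited Λ' := ⟨trNormal c .halt⟩
  have hsupp : TM2.Supports tr (codeSupp c .halt) := tr_supports c .halt
  intro o ho v g o' v' h
  refine Finset.mem_insert_of_mem ?_
  rcases Finset.mem_insert.1 ho with rfl | ho
  · simp only [target, Option.some.injEq, Prod.mk.injEq] at h
    rw [← h.1]
    exact some_tr_mem_stmts hsupp.1
  · rcases o with - | q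
    · simp [target] at h
    cases q <;> simp only [target, Option.some.injEq, Prod.mk.injEq] at h <;> rw [← h.1]
    case goto f => exact some_tr_mem_stmts (TM2.stmts_supportsStmt hsupp ho v)
    case halt => exact Finset.none_mem_insertNone
    case branch f q₁ q₂ =>
      refine TM2.stmts_trans ?_ ho
      split_ifs <;> simp [TM2.stmts₁, TM2.stmts₁_self]
    all_goals
      refine TM2.stmts_trans ?_ ho
      simp [TM2.stmts₁, TM2.stmts₁_self]

theorem halts_iff_eval_dom (c : ToPartrec.Code) (v : List ℕ) :
    (ruleSystem (statements c)).Halts (⟨_, jump_mem_statements c⟩, none, 0)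
      (fun k => value (K'.elim (trList v) [] [] [] k)) ↔ (c.eval v).Dom := by
  rw [halts_goto_iff (isClosed_statements c)]
  have := congrArg Part.Dom (tr_eval c v)
  simpa [init] using this

end StackProgram

/-! ### Computability of the reduction -/

namespace StackNumber

theorem trNat_of_posNum (p : PosNum) : trNat (p : ℕ) = trPosNum p := by
  have h : ((p : ℕ) : Num) = Num.pos p := Num.of_to_nat (Num.pos p)
  rw [trNat, h]
  rfl

theorem exists_posNum {n : ℕ} (hn : n ≠ 0) : ∃ p : PosNum, n = p := by
  have h := Num.to_of_nat n
  cases hp : (n : Num) with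
  | zero =>
    rw [hp] at h
    exact absurd h.symm hn
  | pos p =>
    rw [hp] at h
    exact ⟨p, h.symm⟩

theorem trNat_eq_cons {n : ℕ} (hn : n ≠ 0) :
    trNat n = (if n % 2 = 0 then Γ'.bit0 else Γ'.bit1) :: trNat (n / 2) := by
  obtain ⟨p, rfl⟩ := exists_posNum hn
  cases p with
  | one =>
    rw [trNat_of_posNum]
    simp [trPosNum]
  | bit0 p =>
    rw [trNat_of_posNum]
    have h : (PosNum.bit0 p : ℕ) = p + p := rfl
    rw [h, if_pos (by omega), show ((p : ℕ) + p) / 2 = p by omega, trNat_of_posNum]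
    rfl
  | bit1 p =>
    rw [trNat_of_posNum]
    have h : (PosNum.bit1 p : ℕ) = p + p + 1 := rfl
    rw [h, if_neg (by omega), show ((p : ℕ) + p + 1) / 2 = p by omega, trNat_of_posNum]
    rfl

/-- The number of the stack that contains the list `[n]`. -/
def inputValue (n : ℕ) : ℕ := value (trList [n])

theorem inputValue_zero : inputValue 0 = 2 := by
  simp [inputValue, value, digit]

theorem inputValue_eq {n : ℕ} (hn : n ≠ 0) :
    inputValue n = 5 * inputValue (n / 2) + if n % 2 = 0 then 3 else 4 := by
  simp only [inputValue, trList]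
  rw [trNat_eq_cons hn, List.cons_append, value]
  split_ifs <;> rfl

theorem primrec_inputValue : Primrec inputValue := by
  -- Course-of-values recursion: `l` lists the values at smaller arguments, so `l.length` is the
  -- argument and the entry at `l.length / 2` is the value at its half.
  let g : List ℕ → Option ℕ := fun l =>
    if l.length = 0 then some 2
    else (l[l.length / 2]?).map fun x => 5 * x + if l.length % 2 = 0 then 3 else 4
  have hlen : Primrec (List.length : List ℕ → ℕ) := Primrec.list_length
  have hg : Primrec g := by
    refine Primrec.ite (Primrec.eq.comp hlen (Primrec.const 0)) (Primrec.const _) ?_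
    refine Primrec.option_map
      (Primrec.list_getElem?.comp Primrec.id (Primrec.nat_div.comp hlen (Primrec.const 2))) ?_
    refine Primrec.nat_add.comp (Primrec.nat_mul.comp (Primrec.const 5) Primrec.snd) ?_
    exact Primrec.ite
      (Primrec.eq.comp (Primrec.nat_mod.comp (hlen.comp Primrec.fst) (Primrec.const 2))
        (Primrec.const 0)) (Primrec.const _) (Primrec.const _)
  have := Primrec.nat_strong_rec (fun (_ : Unit) n => inputValue n) (g := fun _ l => g l)
    (hg.comp Primrec.snd) (fun _ n => by
      simp only [g, List.length_map, List.length_range]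
      split_ifs with h h'
      · rw [h, inputValue_zero]
      all_goals
        have : n / 2 < n := by omega
        rw [List.getElem?_map, List.getElem?_range this, inputValue_eq h]
        simp [h'])
  exact this.comp (Primrec.const ()) Primrec.id

end StackNumber

namespace BlockSystem

variable (B : BlockSystem)

theorem primrec_replicate_zero : Primrec fun n : ℕ => List.replicate n 0 :=
  (Primrec.list_map Primrec.list_range (Primrec.const 0).to₂).of_eq fun n => by simp

theorem primrec_word : Primrec word := by
  have h : Primrec fun bs : List (ℕ × ℕ) =>
      bs.flatMap fun b => (b.1 + 2) :: List.replicate b.2 0 :=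
    Primrec.list_flatMap Primrec.id (Primrec.list_cons.comp
      (Primrec.nat_add.comp (Primrec.fst.comp Primrec.snd) (Primrec.const 2))
      (primrec_replicate_zero.comp (Primrec.snd.comp Primrec.snd))).to₂
  refine h.of_eq fun bs => ?_
  induction bs with
  | nil => rfl
  | cons b bs ih => rw [List.flatMap_cons, ih, word, List.cons_append]

theorem primrec_prefixInstrs : Primrec B.prefixInstrs := by
  have hb : Primrec fun p : List ℕ × ℕ => B.base + p.2 :=
    Primrec.nat_add.comp (Primrec.const _) Primrec.snd
  have hcompare : Primrec fun p : (List ℕ × ℕ) × ℕ => B.compareInstr p.1.1 p.1.2 p.2 := by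
    unfold compareInstr
    refine (hb.comp Primrec.fst).pair ((Primrec.option_some.comp Primrec.snd).pair
      ((Primrec.const false).pair (Primrec.pair ?_ (Primrec.const 0))))
    exact Primrec.ite (Primrec.eq.comp Primrec.snd
      ((Primrec.list_getD 0).comp (Primrec.fst.comp Primrec.fst) (Primrec.snd.comp Primrec.fst)))
      (Primrec.succ.comp (hb.comp Primrec.fst)) (Primrec.const 3)
  have hstate : Primrec fun p : List ℕ × ℕ =>
      ((B.base + p.2, none, false, 2, 0) : Instr) ::
        (0 :: (List.range B.numLabels).map fun l => l + 2).map (B.compareInstr p.1 p.2) :=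
    Primrec.list_cons.comp (hb.pair (Primrec.const _))
      (Primrec.list_map (Primrec.const _) hcompare.to₂)
  have hend : Primrec fun u : List ℕ => [((B.base + u.length, some 0, false, 3, 0) : Instr)] :=
    Primrec.list_cons.comp ((Primrec.nat_add.comp (Primrec.const _) Primrec.list_length).pair
      (Primrec.const _)) (Primrec.const [])
  exact Primrec.list_append.comp (Primrec.list_flatMap
    (Primrec.list_range.comp Primrec.list_length) hstate.to₂) hend

theorem primrec_instrs : Primrec B.instrs :=
  Primrec.list_append.comp (Primrec.const _) B.primrec_prefixInstrs

end BlockSystem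

theorem primrec_toTransition {k : ℕ} (j : Fin k) : Primrec (Instr.toTransition j) := by
  have h : Primrec fun r : Instr => (((r.1, r.2.1, Function.update (fun _ => false) j r.2.2.1),
      (r.2.2.2.1, r.2.1.isSome, Pi.single j r.2.2.2.2)) :
      (ℕ × Option ℕ × (Fin k → Bool)) × (ℕ × Bool × (Fin k → SignType))) := by
    have h2 : Primrec fun r : Instr => r.2.1 := Primrec.fst.comp Primrec.snd
    have h3 : Primrec fun r : Instr => r.2.2 := Primrec.snd.comp Primrec.snd
    have h4 : Primrec fun r : Instr => r.2.2.2 := Primrec.snd.comp h3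
    refine (Primrec.fst.pair (h2.pair ?_)).pair ((Primrec.fst.comp h4).pair
      ((Primrec.option_isSome.comp h2).pair ?_))
    · exact (Primrec.dom_finite fun b : Bool => Function.update (fun _ => false) j b).comp
        (Primrec.fst.comp h3)
    · exact (Primrec.dom_finite fun d : SignType => (Pi.single j d : Fin k → SignType)).comp
        (Primrec.snd.comp h4)
  exact (Primrec.of_equiv_symm (e := CounterTransition.equivProd k)).comp h

theorem primrec_checkerMachine {k : ℕ} (j : Fin k) (L start : ℕ)
    (pre : List (CounterTransition k)) {α : Type*} [Primcodable α] {S : α → ℕ} {D : α → List Instr}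
    (hS : Primrec S) (hD : Primrec D) :
    Primrec fun a => checkerMachine j L (S a) start pre (D a) := by
  have h : Primrec fun a => (S a, L, start, [2], pre ++ (D a).map (Instr.toTransition j)) :=
    hS.pair ((Primrec.const _).pair ((Primrec.const _).pair ((Primrec.const _).pair
      (Primrec.list_append.comp (Primrec.const _)
        (Primrec.list_map hD ((primrec_toTransition j).comp Primrec.snd).to₂)))))
  exact (Primrec.of_equiv_symm (e := CounterMachine.equivProd k)).comp h

/-! ### Undecidability -/

/-- An undecidable set of natural numbers. -/
def CodeHalts (n : ℕ) : Prop := (Nat.Partrec.Code.eval (Denumerable.ofNat Nat.Partrec.Code n) 0).Dom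

theorem not_computablePred_codeHalts : ¬ ComputablePred CodeHalts := by
  intro h
  refine ComputablePred.halting_problem 0 (ComputablePred.computable_of_manyOneReducible
    (q := CodeHalts) ⟨Encodable.encode, Computable.encode, fun c => ?_⟩ h)
  simp [CodeHalts]

/-- One universal code for all instances keeps the block system, and with it the alphabet, fixed. -/
theorem exists_code_dom_iff_codeHalts :
    ∃ c : ToPartrec.Code, ∀ n, (c.eval [n]).Dom ↔ CodeHalts n := by
  have h : Partrec fun n : ℕ => Nat.Partrec.Code.eval (Denumerable.ofNat Nat.Partrec.Code n) 0 :=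
    Nat.Partrec.Code.eval_part.comp (Computable.ofNat _) (Computable.const 0)
  obtain ⟨c, hc⟩ := ToPartrec.Code.exists_code (Nat.Partrec'.part_iff₁.2 h)
  refine ⟨c, fun n => ?_⟩
  have := congrArg Part.Dom (hc ⟨[n], rfl⟩)
  simp only [Part.map_eq_map, Part.map_Dom] at this
  exact iff_of_eq this

/-- There is a block system for which it is undecidable whether a history begins with given
blocks. -/
theorem exists_blockSystem : ∃ (B : BlockSystem) (bs : ℕ → List (ℕ × ℕ)), Primrec bs ∧
    (∀ n, bs n ≠ []) ∧ ∀ n, B.HasHistory (bs n) ↔ CodeHalts n := by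
  obtain ⟨c, hc⟩ := exists_code_dom_iff_codeHalts
  let T := StackProgram.statements c
  let r : StackProgram.Rule T := (⟨_, StackProgram.jump_mem_statements c⟩, none, 0)
  refine ⟨(StackProgram.ruleSystem T).blockSystem, fun n =>
    [(RuleSystem.label (r, K'.main), StackNumber.inputValue n),
      (RuleSystem.label (r, K'.rev), 0), (RuleSystem.label (r, K'.aux), 0),
      (RuleSystem.label (r, K'.stack), 0)], ?_, by simp, fun n => ?_⟩
  · exact Primrec.list_cons.comp
      ((Primrec.const _).pair StackNumber.primrec_inputValue) (Primrec.const _)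
  -- The three stacks other than `main` are empty and have value `0`.
  · rw [← hc, ← StackProgram.halts_iff_eval_dom, ← RuleSystem.hasHistory_row]
    rfl

/-- The algorithm may be partial, but it halts on the range of `f`, which lies in `S`; composed with
`f` it is a total computable function that decides `¬ Q`. -/
theorem not_decidableOn_of_reduction {α : Type*} [Primcodable α] {S : Set α} {P : α → Prop}
    {Q : ℕ → Prop} (hQ : ¬ ComputablePred Q) {f : ℕ → α} (hf : Computable f) (hS : ∀ n, f n ∈ S)
    (h : ∀ n, P (f n) ↔ ¬ Q n) : ¬ DecidableOn S P := by
  classical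
  rintro ⟨g, hg, hgS⟩
  refine hQ ⟨fun _ => Classical.propDecidable _, ?_⟩
  have hgf : Computable fun n => decide (P (f n)) := by
    refine (hg.comp hf).of_eq fun n => ?_
    obtain ⟨b, hb, hbP⟩ := hgS (f n) (hS n)
    rw [Part.eq_some_iff.2 hb]
    congr 1
    rw [Bool.eq_iff_iff, hbP, decide_eq_true_iff]
  refine (Primrec.not.to_comp.comp hgf).of_eq fun n => ?_
  rw [Bool.eq_iff_iff]
  simp [h]

theorem proposition7 :
    (¬ DecidableOn (DCM 1 3) fun M => M.language.IsDenseFor Language.suff) ∧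
    (¬ DecidableOn (DCM 2 1) fun M => M.language.IsDenseFor Language.suff) ∧
    (¬ DecidableOn (NCM 1 1) fun M => M.language.IsDenseFor Language.suff) := by
  obtain ⟨B, bs, hbs, hne, hB⟩ := exists_blockSystem
  let u : ℕ → List ℕ := fun n => BlockSystem.word (bs n)
  let S : ℕ → ℕ := fun n => B.base + (u n).length + 1
  let D : ℕ → List Instr := fun n => B.instrs (u n)
  have hu : Primrec u := BlockSystem.primrec_word.comp hbs
  have hS : Primrec S := Primrec.succ.comp
    (Primrec.nat_add.comp (Primrec.const _) (Primrec.list_length.comp hu))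
  have hD : Primrec D := B.primrec_instrs.comp hu
  have hchecker : ∀ n, IsChecker B.numLetters (S n) (D n) := fun n => B.isChecker_instrs _
  have hdense : ∀ n, IsCheckerDense B.numLetters (D n) ↔ ¬ CodeHalts n := fun n => by
    rw [← hB n]
    exact BlockSystem.isCheckerDense_instrs (bs n) (hne n)
  refine ⟨?_, ?_, ?_⟩
  · exact not_decidableOn_of_reduction not_computablePred_codeHalts
      (f := fun n => countMachine (0 : Fin 1) 0 B.numLetters (S n) (D n))
      (primrec_checkerMachine _ _ _ _ hS hD).to_comp
      (fun n => countMachine_mem_DCM_one (hchecker n))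
      (fun n => (isDenseFor_suff_countMachine (hchecker n) 0 0).trans (hdense n))
  · exact not_decidableOn_of_reduction not_computablePred_codeHalts
      (f := fun n => countMachine (0 : Fin 2) 1 B.numLetters (S n) (D n))
      (primrec_checkerMachine _ _ _ _ hS hD).to_comp
      (fun n => countMachine_mem_DCM_two (hchecker n))
      (fun n => (isDenseFor_suff_countMachine (hchecker n) 0 1).trans (hdense n))
  · exact not_decidableOn_of_reduction not_computablePred_codeHalts
      (f := fun n => guessMachine B.numLetters (S n) (D n))
      (primrec_checkerMachine _ _ _ _ hS hD).to_comp
      (fun n => guessMachine_mem_NCM (hchecker n))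
      (fun n => (isDenseFor_suff_guessMachine (hchecker n)).trans (hdense n))
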